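/- Let $B$ (blue) and $R$ (red) be disjoint finite sets of points in the Euclidean plane, with $b=|B|$ and $r=|R|$, such that $P=B\cup R$ is in general position, that is, no three distinct points of $P$ lie on a common line. Call a line $\ell$ balanced if it is spanned by (passes through) one blue point and one red point, and on each of the two open halfplanes bounded by $\ell$, the number of blue points of $P$ minus the number of red points of $P$ equals $(b-r)/2$. If $b\ge r$ and $b+r$ is even, then there are at least $r$ distinct balanced lines. -/

import Mathlib

/-- The Euclidean plane. -/
abbrev Plane : Type := EuclideanSpace ℝ (Fin 2)

/-- A set of points in the plane is in general position if no three distinct points of it lie on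
a common line. -/
def InGeneralPosition (P : Set Plane) : Prop :=
  ∀ p ∈ P, ∀ q ∈ P, ∀ s ∈ P, p ≠ q → p ≠ s → q ≠ s → ¬ Collinear ℝ {p, q, s}

/-- The open halfplanes of a line `l`: for each point `x` off the line, the set of all points
strictly on the same side of `l` as `x`. -/
def IsOpenHalfplane (l : AffineSubspace ℝ Plane) (H : Set Plane) : Prop :=
  ∃ x : Plane, x ∉ l ∧ H = {y | l.SSameSide x y}

/-- The number of blue points minus the number of red points in a region `H`, as an integer. -/
noncomputable def excess (B R : Finset Plane) (H : Set Plane) : ℤ :=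
  ((↑B ∩ H : Set Plane).ncard : ℤ) - ((↑R ∩ H : Set Plane).ncard : ℤ)

/-- A line is balanced for the blue set `B` and the red set `R` if it is spanned by a blue point
and a red point, and on each of its open halfplanes the number of blue points minus the number of
red points is `(|B| - |R|) / 2` (written without division). -/
def IsBalancedLine (B R : Finset Plane) (l : AffineSubspace ℝ Plane) : Prop :=
  (∃ p ∈ B, ∃ q ∈ R, p ≠ q ∧ l = line[ℝ, p, q]) ∧
    ∀ H : Set Plane, IsOpenHalfplane l H → 2 * excess B R H = (B.card : ℤ) - (R.card : ℤ)

/-! Sweeping a line over all slopes orders the points from below to above and yields an allowable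
sequence: consecutive orders differ by a swap of neighbours, and after all `M` pairs the order is
reversed. Give blue points weight `1` and red points weight `-1`, put `d = (b - r) / 2`, and let the
level of a cut be the weight before it minus `d`. A bichromatic pair spans a balanced line when the
level just before the pair is zero at its swap.

Color the cells (time, every second cut) by the sign of the level, which is odd there. A swap alters
a single level, and it can flip a sign only if the swap is bichromatic and balanced
(`balanced_of_negRegion_ne`). So it suffices to find `r` sign flips. The reversal says that a glide
reflection carries the negative region to its complement, hence the walk along the boundary of that
region descends to a permutation of a finite quotient. Its total winding is `1` (`sum_wind`), so
some cycle winds an odd number of times (`exists_odd_cycle`). It lifts to a walk from a vertex to an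
odd glide translate, whose vertical steps use distinct flips (`exists_odd_walk`).

The level vanishes at every vertex of this walk. If the walk ends no earlier than it starts, follow
the set of red points before the cut. A forward step moves no red point across the cut. At equal
times two such sets are nested and their difference is paid for by the vertical steps in between;
whatever backward steps do is thus controlled once the walk returns to the same time
(`card_symmDiff_le_of_walk`). At the end the order is reversed and the red set has been
complemented, so there are at least `r` vertical steps. If the walk ends earlier, it is read
backwards with blue in place of red. -/

/-! ### Boundary walks in a two-colored grid -/

/-- One step along the boundary of the region `N` of the grid `ℤ × ℤ` of cells, keeping the region
on the right.  The vertex `(s, v)` is the common corner of the cells in the columns `s`, `s + 1` and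
the rows `v`, `v + 1`. -/
def boundaryStep (N : ℤ → ℤ → Bool) (x : ℤ × ℤ) : ℤ × ℤ :=
  if N (x.1 + 1) x.2 && !N (x.1 + 1) (x.2 + 1) then (x.1 + 1, x.2)
  else if !N x.1 x.2 && N x.1 (x.2 + 1) then (x.1 - 1, x.2)
  else if !N x.1 (x.2 + 1) && N (x.1 + 1) (x.2 + 1) then (x.1, x.2 + 1)
  else if N x.1 x.2 && !N (x.1 + 1) x.2 then (x.1, x.2 - 1)
  else x

/-- The inverse of `boundaryStep`. -/
def boundaryStepBack (N : ℤ → ℤ → Bool) (x : ℤ × ℤ) : ℤ × ℤ :=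
  if N x.1 x.2 && !N x.1 (x.2 + 1) then (x.1 - 1, x.2)
  else if !N (x.1 + 1) x.2 && N (x.1 + 1) (x.2 + 1) then (x.1 + 1, x.2)
  else if !N x.1 x.2 && N (x.1 + 1) x.2 then (x.1, x.2 - 1)
  else if N x.1 (x.2 + 1) && !N (x.1 + 1) (x.2 + 1) then (x.1, x.2 + 1)
  else x

/-- Between consecutive columns at most one cell changes. -/
def OneFlip (N : ℤ → ℤ → Bool) : Prop :=
  ∀ s i i', N s i ≠ N (s + 1) i → N s i' ≠ N (s + 1) i' → i = i'

/-- A checkerboard around a vertex would need two changes between the same two columns. Without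
checkerboards at most one boundary edge enters and one leaves each vertex. -/
lemma boundaryStepBack_boundaryStep {N : ℤ → ℤ → Bool} (h : OneFlip N) (x : ℤ × ℤ) :
    boundaryStepBack N (boundaryStep N x) = x := by
  obtain ⟨s, v⟩ := x
  have h0 := h s v (v + 1)
  have h1 := h (s + 1) v (v + 1)
  have h2 := h (s - 1) v (v + 1)
  have h3 := h s v (v - 1)
  have h4 := h s (v + 1) (v + 2)
  have e1 : s - 1 + 1 = s := by ring
  have e2 : v - 1 + 1 = v := by ring
  have e3 : v + 1 + 1 = v + 2 := by ring
  unfold boundaryStep boundaryStepBack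
  grind

lemma boundaryStep_injective {N : ℤ → ℤ → Bool} (h : OneFlip N) :
    Function.Injective (boundaryStep N) :=
  Function.LeftInverse.injective (boundaryStepBack_boundaryStep h)

/-! ### Colorings negated by a glide reflection -/

/-- The glide reflection `(s, v) ↦ (s + M, r - v)`. -/
def glide (M r : ℤ) : Equiv.Perm (ℤ × ℤ) where
  toFun x := (x.1 + M, r - x.2)
  invFun x := (x.1 - M, r - x.2)
  left_inv x := by ext <;> simp
  right_inv x := by ext <;> simp

lemma glide_apply (M r : ℤ) (x : ℤ × ℤ) : glide M r x = (x.1 + M, r - x.2) := rfl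

lemma glide_sq_zpow (M r k : ℤ) (x : ℤ × ℤ) :
    ((glide M r) ^ (2 * k)) x = (x.1 + 2 * k * M, x.2) := by
  induction k using Int.induction_on with
  | zero => simp
  | succ k ih =>
    have : (2 * ((k : ℤ) + 1)) = 1 + (1 + 2 * k) := by ring
    rw [this, zpow_add, zpow_add, Equiv.Perm.mul_apply, Equiv.Perm.mul_apply, ih]
    simp [glide_apply]; ring
  | pred k ih =>
    have : (2 * (-(k : ℤ) - 1)) = -1 + (-1 + 2 * (-k)) := by ring
    rw [this, zpow_add, zpow_add, Equiv.Perm.mul_apply, Equiv.Perm.mul_apply, ih]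
    simp only [zpow_neg, zpow_one, Equiv.Perm.inv_def]
    simp [glide, Equiv.symm]; ring

lemma glide_zpow_of_odd (M r : ℤ) {w : ℤ} (hw : Odd w) (x : ℤ × ℤ) :
    ((glide M r) ^ w) x = (x.1 + w * M, r - x.2) := by
  obtain ⟨k, rfl⟩ := hw
  rw [zpow_add, Equiv.Perm.mul_apply, zpow_one, glide_apply, glide_sq_zpow]
  ext <;> simp; ring

/-- A two-coloring of the cells that is negated by the glide reflection, has all low rows in the
region and all high rows outside it. -/
structure GlideColoring (N : ℤ → ℤ → Bool) (M r : ℤ) : Prop where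
  oneFlip : OneFlip N
  low : ∀ s i, i ≤ 0 → N s i = true
  high : ∀ s i, r + 1 ≤ i → N s i = false
  anti : ∀ s i, N (s + M) (r + 1 - i) = !N s i

/-- The glide reverses orientation and also exchanges the region with its complement, so the region
stays on the right. -/
lemma GlideColoring.boundaryStep_glide {N : ℤ → ℤ → Bool} {M r : ℤ} (h : GlideColoring N M r)
    (x : ℤ × ℤ) : boundaryStep N (glide M r x) = glide M r (boundaryStep N x) := by
  obtain ⟨s, v⟩ := x
  have h1 := h.anti s v
  have h2 := h.anti s (v + 1)
  have h3 := h.anti (s + 1) v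
  have h4 := h.anti (s + 1) (v + 1)
  have h0 := h.oneFlip s v (v + 1)
  have e1 : s + 1 + M = s + M + 1 := by ring
  have e2 : r + 1 - v = r - v + 1 := by ring
  have e3 : r + 1 - (v + 1) = r - v := by ring
  rw [e1] at h3 h4
  rw [e2] at h1 h3
  rw [e3] at h2 h4
  simp only [boundaryStep, glide_apply, h1, h2, h3, h4]
  clear h1 h2 h3 h4 e1 e2 e3
  cases hA : N s v <;> cases hB : N s (v + 1) <;> cases hC : N (s + 1) v <;>
    cases hD : N (s + 1) (v + 1) <;> simp [hA, hB, hC, hD] at h0 ⊢ <;> ring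

lemma GlideColoring.boundaryStep_glide_zpow {N : ℤ → ℤ → Bool} {M r : ℤ} (h : GlideColoring N M r)
    (w : ℤ) (x : ℤ × ℤ) :
    boundaryStep N ((glide M r ^ w) x) = (glide M r ^ w) (boundaryStep N x) := by
  have key : ∀ x, boundaryStep N ((glide M r)⁻¹ x) =
      (glide M r)⁻¹ (boundaryStep N x) := by
    intro x
    rw [Equiv.Perm.eq_inv_iff_eq, ← h.boundaryStep_glide]
    simp
  induction w using Int.induction_on generalizing x with
  | zero => simp
  | succ k ih => rw [zpow_add_one, Equiv.Perm.mul_apply, ih, h.boundaryStep_glide]; rfl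
  | pred k ih => rw [zpow_sub_one, Equiv.Perm.mul_apply, ih, key]; rfl

/-! ### The boundary walk on the quotient and its odd cycle -/

/-- A permutation of a finite type along which an integer weight has an odd total has a cycle of
odd weight. -/
lemma exists_odd_cycle {X : Type*} [Fintype X] [DecidableEq X] (g : Equiv.Perm X) (ω : X → ℤ)
    (hodd : Odd (∑ x, ω x)) :
    ∃ x : X, ∃ m : ℕ, (g ^ m) x = x ∧ Set.InjOn (fun i : ℕ => (g ^ i) x) (Set.Iio m) ∧
      Odd (∑ i ∈ Finset.range m, ω ((g ^ i) x)) := by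
  classical
  by_contra! hcon
  rw [← Int.not_even_iff_odd] at hodd
  apply hodd
  -- If every cycle had even weight, so would their union.
  rw [Finset.sum_partition (Equiv.Perm.SameCycle.setoid g)]
  refine Finset.even_sum _ fun y _ => ?_
  induction y using Quotient.inductionOn with
  | h x =>
  have hx := hcon x (Function.minimalPeriod g x)
    (by rw [← Equiv.Perm.iterate_eq_pow]; exact Function.iterate_minimalPeriod)
    (by
      have := Function.iterate_injOn_Iio_minimalPeriod (f := g) (x := x)
      intro i hi j hj hij
      exact this hi hj (by simpa [Equiv.Perm.iterate_eq_pow] using hij))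
  rw [Int.not_odd_iff_even] at hx
  refine (congrArg Even ?_).mp hx
  refine Finset.sum_bij (fun i _ => (g ^ i) x) ?_ ?_ ?_ ?_
  · intro i _
    simp only [Finset.mem_filter, Finset.mem_univ, true_and]
    refine Quotient.sound ?_
    exact (Equiv.Perm.SameCycle.refl g x).pow_left
  · intro i hi j hj hij
    have := Function.iterate_injOn_Iio_minimalPeriod (f := g) (x := x)
    exact this (by simpa using hi) (by simpa using hj)
      (by simpa [Equiv.Perm.iterate_eq_pow] using hij)
  · intro y hy
    simp only [Finset.mem_filter, Finset.mem_univ, true_and] at hy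
    have hy' : g.SameCycle x y := (Quotient.exact hy : g.SameCycle y x).symm
    obtain ⟨i, hi⟩ := hy'.exists_nat_pow_eq
    have hpos : 0 < Function.minimalPeriod g x := by
      apply Function.minimalPeriod_pos_of_mem_periodicPts
      exact Function.mem_periodicPts.2 ⟨orderOf g, orderOf_pos g, by
        simp [Function.IsPeriodicPt, Function.IsFixedPt, Equiv.Perm.iterate_eq_pow,
          pow_orderOf_eq_one]⟩
    refine ⟨i % Function.minimalPeriod g x, by simpa using Nat.mod_lt _ hpos, ?_⟩
    have := Function.iterate_mod_minimalPeriod_eq (f := g) (x := x) (n := i)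
    simp only [Equiv.Perm.iterate_eq_pow] at this
    rw [this, hi]
  · intro i _; rfl

/-- The vertices `(s, v)` with `0 ≤ s < M` and `0 ≤ v ≤ r`, a fundamental domain of the glide
reflection. -/
abbrev Strip (M r : ℤ) : Type := {x : ℤ × ℤ // x ∈ Finset.Ico 0 M ×ˢ Finset.Icc 0 r}

/-- The number of glide reflections that `boundaryStep` makes relative to the fundamental strip. -/
def wind (N : ℤ → ℤ → Bool) (M : ℤ) (x : ℤ × ℤ) : ℤ :=
  if (boundaryStep N x).1 = M then 1 else if (boundaryStep N x).1 = -1 then -1 else 0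

lemma boundaryStep_fst (N : ℤ → ℤ → Bool) (x : ℤ × ℤ) :
    (boundaryStep N x).1 = x.1 + 1 ∨ (boundaryStep N x).1 = x.1 - 1 ∨
      (boundaryStep N x).1 = x.1 := by
  unfold boundaryStep
  split_ifs <;> simp

lemma boundaryStep_snd (N : ℤ → ℤ → Bool) (x : ℤ × ℤ) :
    (boundaryStep N x).2 = x.2 + 1 ∨ (boundaryStep N x).2 = x.2 - 1 ∨
      (boundaryStep N x).2 = x.2 := by
  unfold boundaryStep
  split_ifs <;> simp

lemma boundaryStep_snd_of_fst_ne {N : ℤ → ℤ → Bool} {x : ℤ × ℤ} (h : (boundaryStep N x).1 ≠ x.1) :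
    (boundaryStep N x).2 = x.2 := by
  unfold boundaryStep at h ⊢
  split_ifs at h ⊢ <;> simp_all

lemma boundaryStep_fst_eq_add_one {N : ℤ → ℤ → Bool} {x : ℤ × ℤ} :
    (boundaryStep N x).1 = x.1 + 1 ↔ N (x.1 + 1) x.2 = true ∧ N (x.1 + 1) (x.2 + 1) = false := by
  unfold boundaryStep
  split_ifs with h1 h2 h3 h4 <;> simp_all; grind

/-- `OneFlip` is needed here, unlike for a step to the right: it rules out that an earlier branch of
`boundaryStep` takes precedence. -/
lemma boundaryStep_fst_eq_sub_one {N : ℤ → ℤ → Bool} (h : OneFlip N) {x : ℤ × ℤ} :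
    (boundaryStep N x).1 = x.1 - 1 ↔ N x.1 x.2 = false ∧ N x.1 (x.2 + 1) = true := by
  have := h x.1 x.2 (x.2 + 1)
  unfold boundaryStep
  grind

lemma boundaryStep_snd_eq_add_one {N : ℤ → ℤ → Bool} (h : OneFlip N) {x : ℤ × ℤ} :
    (boundaryStep N x).2 = x.2 + 1 ↔
      N x.1 (x.2 + 1) = false ∧ N (x.1 + 1) (x.2 + 1) = true := by
  have := h x.1 x.2 (x.2 + 1)
  unfold boundaryStep
  grind

lemma boundaryStep_snd_eq_sub_one {N : ℤ → ℤ → Bool} (h : OneFlip N) {x : ℤ × ℤ} :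
    (boundaryStep N x).2 = x.2 - 1 ↔ N x.1 x.2 = true ∧ N (x.1 + 1) x.2 = false := by
  have := h x.1 x.2 (x.2 + 1)
  unfold boundaryStep
  grind

lemma GlideColoring.boundaryStep_snd_mem {N : ℤ → ℤ → Bool} {M r : ℤ} (h : GlideColoring N M r)
    {x : ℤ × ℤ} (hx : x.2 ∈ Finset.Icc 0 r) : (boundaryStep N x).2 ∈ Finset.Icc 0 r := by
  rw [Finset.mem_Icc] at hx ⊢
  rcases boundaryStep_snd N x with h' | h' | h'
  · have h2 := (boundaryStep_snd_eq_add_one h.oneFlip).1 h'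
    have hr : ¬ r + 1 ≤ x.2 + 1 := fun hr => by simp [h.high _ _ hr] at h2
    omega
  · have h2 := (boundaryStep_snd_eq_sub_one h.oneFlip).1 h'
    have hr : ¬ x.2 ≤ 0 := fun hr => by simp [h.low _ _ hr] at h2
    omega
  · omega

lemma glide_zpow_fst (M r k : ℤ) (x : ℤ × ℤ) : ((glide M r ^ k) x).1 = x.1 + k * M := by
  rcases Int.even_or_odd k with hk | hk
  · obtain ⟨l, rfl⟩ := hk
    rw [← two_mul, glide_sq_zpow]
  · rw [glide_zpow_of_odd M r hk]

lemma GlideColoring.reduce_mem {N : ℤ → ℤ → Bool} {M r : ℤ} (h : GlideColoring N M r)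
    (hM : 0 < M) (x : Strip M r) :
    (glide M r ^ (-wind N M x)) (boundaryStep N x) ∈ Finset.Ico 0 M ×ˢ Finset.Icc 0 r := by
  obtain ⟨x, hx⟩ := x
  rw [Finset.mem_product] at hx ⊢
  have h2 := h.boundaryStep_snd_mem hx.2
  have h1 := boundaryStep_fst N x
  have hx1 := hx.1
  simp only [Finset.mem_Ico, Finset.mem_Icc] at h2 hx1 ⊢
  unfold wind
  split_ifs with ha hb
  · rw [glide_zpow_of_odd M r (by decide)]
    dsimp only
    omega
  · rw [glide_zpow_of_odd M r (by decide)]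
    dsimp only
    omega
  · simp only [neg_zero, zpow_zero, Equiv.Perm.coe_one, id]
    omega

/-- `boundaryStep` on the quotient by the glide reflection. -/
noncomputable def GlideColoring.stripPerm {N : ℤ → ℤ → Bool} {M r : ℤ} (h : GlideColoring N M r)
    (hM : 0 < M) : Equiv.Perm (Strip M r) :=
  Equiv.ofBijective
    (fun x => ⟨(glide M r ^ (-wind N M x)) (boundaryStep N x), h.reduce_mem hM x⟩) <| by
    rw [← Finite.injective_iff_bijective]
    intro x y hxy
    have h1 := congrArg Subtype.val hxy
    dsimp only at h1
    rw [← h.boundaryStep_glide_zpow, ← h.boundaryStep_glide_zpow] at h1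
    have h2 := boundaryStep_injective h.oneFlip h1
    have hx := (Finset.mem_product.1 x.2).1
    have hy := (Finset.mem_product.1 y.2).1
    have h3 := congrArg Prod.fst h2
    rw [glide_zpow_fst, glide_zpow_fst] at h3
    rw [Finset.mem_Ico] at hx hy
    -- Both columns lie in `[0, M)`, so a multiple of `M` separating them is zero.
    have h4 : wind N M x = wind N M y := by
      have h5 : (wind N M x - wind N M y) * M = x.1.1 - y.1.1 := by linarith
      have h6 : (wind N M x - wind N M y) < 1 := by nlinarith
      have h7 : -1 < (wind N M x - wind N M y) := by nlinarith
      omega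
    rw [h4] at h2
    exact Subtype.ext ((glide M r ^ (-wind N M y)).injective h2)

lemma GlideColoring.boundaryStep_eq {N : ℤ → ℤ → Bool} {M r : ℤ} (h : GlideColoring N M r)
    (hM : 0 < M) (x : Strip M r) :
    boundaryStep N x = (glide M r ^ wind N M x) (h.stripPerm hM x) := by
  simp [stripPerm]

lemma GlideColoring.iterate_boundaryStep {N : ℤ → ℤ → Bool} {M r : ℤ} (h : GlideColoring N M r)
    (hM : 0 < M) (x : Strip M r) (i : ℕ) :
    (boundaryStep N)^[i] x = (glide M r ^ (∑ j ∈ Finset.range i, wind N M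
      ((h.stripPerm hM ^ j) x : Strip M r))) ((h.stripPerm hM ^ i) x : Strip M r) := by
  induction i with
  | zero => simp
  | succ i ih =>
    rw [Function.iterate_succ_apply', ih, h.boundaryStep_glide_zpow, h.boundaryStep_eq hM,
      Finset.sum_range_succ, zpow_add, Equiv.Perm.mul_apply, pow_succ', Equiv.Perm.mul_apply]

/-- The sum counts, with sign, the boundary edges crossing a single column. Going up a column, the
color starts inside the region and ends outside it, so the signed count is one. -/
lemma GlideColoring.sum_wind {N : ℤ → ℤ → Bool} {M r : ℤ} (h : GlideColoring N M r)
    (hM : 0 < M) (hr : 0 ≤ r) : ∑ x : Strip M r, wind N M x = 1 := by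
  have e1 : ∑ x : Strip M r, wind N M x =
      ∑ x ∈ Finset.Ico 0 M ×ˢ Finset.Icc 0 r, wind N M x :=
    Finset.sum_coe_sort (Finset.Ico 0 M ×ˢ Finset.Icc 0 r) (fun x => wind N M x)
  have e2 : ∀ x ∈ Finset.Ico 0 M ×ˢ Finset.Icc 0 r, wind N M x =
      (if x.1 = M - 1 then (if N M x.2 = true ∧ N M (x.2 + 1) = false then 1 else 0) else 0) -
      (if x.1 = 0 then (if N 0 x.2 = false ∧ N 0 (x.2 + 1) = true then 1 else 0) else 0) := by
    rintro ⟨s, v⟩ hx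
    have hs := (Finset.mem_product.1 hx).1
    have h1 := boundaryStep_fst N (s, v)
    have h2 := boundaryStep_fst_eq_add_one (N := N) (x := (s, v))
    have h3 := boundaryStep_fst_eq_sub_one h.oneFlip (x := (s, v))
    rw [Finset.mem_Ico] at hs
    simp only at hs h1 h2 h3 ⊢
    unfold wind
    by_cases ha : s = M - 1
    · subst ha
      rw [show M - 1 + 1 = M by ring] at h2
      by_cases hb : M - 1 = 0
      · grind
      · grind
    · grind
  -- The glide carries column `0` to column `M`; flipping both the rows and the colors preserves the
  -- direction of a color change.
  have e3 : ∀ v, (N M v = true ∧ N M (v + 1) = false) ↔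
      (N 0 (r - v) = true ∧ N 0 (r - v + 1) = false) := by
    intro v
    have h1 := h.anti 0 (r - v)
    have h2 := h.anti 0 (r - v + 1)
    rw [zero_add, show r + 1 - (r - v) = v + 1 by ring] at h1
    rw [zero_add, show r + 1 - (r - v + 1) = v by ring] at h2
    rw [h1, h2]
    cases N 0 (r - v) <;> cases N 0 (r - v + 1) <;> simp
  rw [e1, Finset.sum_congr rfl e2, Finset.sum_sub_distrib, Finset.sum_product, Finset.sum_product]
  simp only [e3]
  have e4 : ∑ x ∈ Finset.Ico 0 M, ∑ y ∈ Finset.Icc 0 r, (if x = M - 1 then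
      (if N 0 (r - y) = true ∧ N 0 (r - y + 1) = false then (1 : ℤ) else 0) else 0) =
      ∑ y ∈ Finset.Icc 0 r, (if N 0 y = true ∧ N 0 (y + 1) = false then (1 : ℤ) else 0) := by
    rw [Finset.sum_eq_single (M - 1)]
    · simp only [if_true]
      refine Finset.sum_bij' (fun y _ => r - y) (fun y _ => r - y) ?_ ?_ ?_ ?_ ?_ <;> grind
    · intro b _ hb; simp [hb]
    · intro hb; exact absurd (Finset.mem_Ico.2 ⟨by omega, by omega⟩) hb
  have e5 : ∑ x ∈ Finset.Ico 0 M, ∑ y ∈ Finset.Icc 0 r, (if x = 0 then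
      (if N 0 y = false ∧ N 0 (y + 1) = true then (1 : ℤ) else 0) else 0) =
      ∑ y ∈ Finset.Icc 0 r, (if N 0 y = false ∧ N 0 (y + 1) = true then (1 : ℤ) else 0) := by
    rw [Finset.sum_eq_single 0]
    · simp only [if_true]
    · intro b _ hb; simp [hb]
    · intro hb; exact absurd (Finset.mem_Ico.2 ⟨by omega, by omega⟩) hb
  rw [e4, e5, ← Finset.sum_sub_distrib]
  -- The summand is the indicator of the region at `y` minus that at `y + 1`, so the sum telescopes.
  have e6 : ∀ n : ℕ, ∑ y ∈ Finset.Icc (0 : ℤ) n,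
      ((if N 0 y = true ∧ N 0 (y + 1) = false then (1 : ℤ) else 0) -
        (if N 0 y = false ∧ N 0 (y + 1) = true then (1 : ℤ) else 0)) =
      (if N 0 0 = true then 1 else 0) - (if N 0 (n + 1) = true then 1 else 0) := by
    intro n
    induction n with
    | zero =>
      rw [Nat.cast_zero, Finset.Icc_self, Finset.sum_singleton, zero_add]
      cases N 0 0 <;> cases N 0 1 <;> simp
    | succ n ih =>
      have : Finset.Icc (0 : ℤ) ((n + 1 : ℕ) : ℤ) =
          insert ((n : ℤ) + 1) (Finset.Icc (0 : ℤ) n) := by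
        ext z; simp; omega
      rw [this, Finset.sum_insert (by simp), ih]
      push_cast
      cases N 0 (n + 1) <;> cases N 0 (n + 1 + 1) <;>
        (simp; try ring)
  obtain ⟨n, rfl⟩ := Int.eq_ofNat_of_zero_le hr
  rw [e6 n, h.low _ _ le_rfl, h.high _ _ le_rfl]
  simp

lemma glide_zpow_snd_eq (M r k : ℤ) {x y : ℤ × ℤ} (hxy : x.2 = y.2) :
    ((glide M r ^ k) x).2 = ((glide M r ^ k) y).2 := by
  rcases Int.even_or_odd k with hk | hk
  · obtain ⟨l, rfl⟩ := hk
    rw [← two_mul, glide_sq_zpow, glide_sq_zpow, hxy]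
  · rw [glide_zpow_of_odd M r hk, glide_zpow_of_odd M r hk, hxy]

/-- The changing cell and the direction of its change determine the vertex, so each column is
charged for at most one vertical step. -/
lemma exists_flip_of_boundaryStep_snd_ne {N : ℤ → ℤ → Bool} (h : OneFlip N) {x : ℤ × ℤ}
    (hx : (boundaryStep N x).2 ≠ x.2) :
    ∃ i, N x.1 i ≠ N (x.1 + 1) i ∧ x.2 = if N x.1 i then i else i - 1 := by
  rcases boundaryStep_snd N x with h' | h' | h'
  · have h2 := (boundaryStep_snd_eq_add_one h).1 h'
    exact ⟨x.2 + 1, by simp [h2], by simp [h2]⟩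
  · have h2 := (boundaryStep_snd_eq_sub_one h).1 h'
    exact ⟨x.2, by simp [h2], by simp [h2]⟩
  · exact absurd h' hx

open Classical in
/-- There is a walk along the boundary of the region that ends at an odd glide-translate of its
starting point and whose vertical steps use distinct cell changes modulo the glide reflection. -/
theorem GlideColoring.exists_odd_walk {N : ℤ → ℤ → Bool} {M r : ℤ} (h : GlideColoring N M r)
    (hM : 0 < M) (hr : 0 ≤ r) :
    ∃ (y : ℕ → ℤ × ℤ) (m : ℕ) (w : ℤ), (∀ i, y (i + 1) = boundaryStep N (y i)) ∧
      (∀ i, y (i + 1) ≠ y i) ∧ Odd w ∧ y m = ((y 0).1 + w * M, r - (y 0).2) ∧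
      ((Finset.range m).filter fun i => (y (i + 1)).2 ≠ (y i).2).card ≤
        ((Finset.Ico 0 M).filter fun s => ∃ i, N s i ≠ N (s + 1) i).card := by
  classical
  obtain ⟨x, m, hm, hinj, hw⟩ := exists_odd_cycle (h.stripPerm hM) (fun x => wind N M x)
    (by rw [h.sum_wind hM hr]; decide)
  set w := ∑ i ∈ Finset.range m, wind N M ((h.stripPerm hM ^ i) x : Strip M r) with hwdef
  have hend : (boundaryStep N)^[m] x = (x.1.1 + w * M, r - x.1.2) := by
    rw [h.iterate_boundaryStep hM, hm, glide_zpow_of_odd M r hw]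
  refine ⟨fun i => (boundaryStep N)^[i] x, m, w, fun i => Function.iterate_succ_apply' _ _ _,
    fun i hi => ?_, hw, hend, ?_⟩
  -- A pause anywhere would, by injectivity, freeze the walk at its start, but its end is shifted by
  -- `w * M ≠ 0`.
  · have h1 : boundaryStep N x = x.1 := by
      apply (boundaryStep_injective h.oneFlip).iterate i
      rw [← Function.iterate_succ_apply]; exact hi
    have h2 : (boundaryStep N)^[m] x = x.1 := Function.iterate_fixed h1 m
    rw [h2] at hend
    have h3 := congrArg Prod.fst hend
    have h4 : w * M = 0 := by simpa using h3
    rcases mul_eq_zero.1 h4 with h5 | h5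
    · rw [h5] at hw; exact absurd hw (by decide)
    · omega
  · have key : ∀ i, ((boundaryStep N)^[i + 1] x).2 ≠ ((boundaryStep N)^[i] x).2 →
        (boundaryStep N ((h.stripPerm hM ^ i) x : Strip M r)).2 ≠
          ((h.stripPerm hM ^ i) x : Strip M r).1.2 := by
      intro i hi hi'
      apply hi
      rw [Function.iterate_succ_apply', h.iterate_boundaryStep hM, h.boundaryStep_glide_zpow]
      exact glide_zpow_snd_eq M r _ hi'
    refine Finset.card_le_card_of_injOn (fun i => ((h.stripPerm hM ^ i) x : Strip M r).1.1) ?_ ?_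
    · intro i hi
      obtain ⟨j, hj, -⟩ := exists_flip_of_boundaryStep_snd_ne h.oneFlip
        (key i (Finset.mem_filter.1 hi).2)
      exact Finset.mem_filter.2
        ⟨(Finset.mem_product.1 ((h.stripPerm hM ^ i) x : Strip M r).2).1, j, hj⟩
    · intro i hi j hj hij
      have hi' := Finset.mem_filter.1 hi
      have hj' := Finset.mem_filter.1 hj
      refine hinj (Finset.mem_range.1 hi'.1) (Finset.mem_range.1 hj'.1) (Subtype.ext ?_)
      obtain ⟨k, hk, hk'⟩ := exists_flip_of_boundaryStep_snd_ne h.oneFlip (key i hi'.2)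
      obtain ⟨l, hl, hl'⟩ := exists_flip_of_boundaryStep_snd_ne h.oneFlip (key j hj'.2)
      dsimp only at hij
      rw [← hij] at hl hl'
      have hkl := h.oneFlip _ _ _ hk hl
      subst hkl
      exact Prod.ext hij (hk'.trans hl'.symm)

/-! ### Counting tools -/

/-- If sets only change while time stands still or decreases, and at equal times their difference
is bounded by the accumulated cost, then this bound holds whenever time has not decreased. -/
lemma card_symmDiff_le_of_walk {P : Type*} [DecidableEq P] {τ : ℕ → ℤ} {A : ℕ → Finset P}
    {E : ℕ → ℕ} {m : ℕ} (hτ : ∀ i < m, τ (i + 1) ≤ τ i + 1)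
    (hfwd : ∀ i < m, τ (i + 1) = τ i + 1 → A (i + 1) = A i)
    (hsame : ∀ i j, i ≤ j → j ≤ m → τ i = τ j →
      (symmDiff (A i) (A j)).card ≤ ∑ k ∈ Finset.Ico i j, E k)
    (i j : ℕ) (hij : i ≤ j) (hj : j ≤ m) (hle : τ i ≤ τ j) :
    (symmDiff (A i) (A j)).card ≤ ∑ k ∈ Finset.Ico i j, E k := by
  obtain ⟨d, hd⟩ : ∃ d, d = j - i := ⟨_, rfl⟩
  induction d using Nat.strong_induction_on generalizing i with
  | _ d ih =>
  rcases hle.eq_or_lt with heq | hlt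
  · exact hsame i j hij hj heq
  · classical
    -- Take the last index whose time is at most the starting time. As time grows by at most one per
    -- step, this index has exactly the starting time and the next step is forward, hence free; the
    -- rest follows by induction.
    obtain ⟨v, hv, hmax⟩ := ((Finset.Icc i j).filter fun v => τ v ≤ τ i).exists_max_image id
      ⟨i, by simp [hij]⟩
    simp only [Finset.mem_filter, Finset.mem_Icc, id] at hv hmax
    have hvj : v < j := lt_of_le_of_ne hv.1.2 (by rintro rfl; omega)
    have h1 : τ i < τ (v + 1) := by
      by_contra hcon
      have := hmax (v + 1) ⟨⟨by omega, by omega⟩, by omega⟩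
      omega
    have h2 := hτ v (by omega)
    have h3 := hsame i v hv.1.1 (by omega) (by omega)
    have h4 := hfwd v (by omega) (by omega)
    have h5 := ih (j - (v + 1)) (by omega) (v + 1) (by omega) (by omega) rfl
    rw [h4] at h5
    have h6 := Finset.sum_Ico_consecutive E hv.1.1 hvj.le
    have h7 := Finset.sum_Ico_consecutive E (Nat.le_succ v) hvj
    have h8 : (symmDiff (A i) (A j)).card ≤
        (symmDiff (A i) (A v)).card + (symmDiff (A v) (A j)).card := by
      refine (Finset.card_le_card ?_).trans (Finset.card_union_le _ _)
      exact symmDiff_triangle (A i) (A v) (A j)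
    simp only [Nat.succ_eq_add_one] at h7
    omega

/-- For signs, twice the indicator of `c p = ε` is `1 + ε * c p`. -/
lemma two_mul_card_filter {P : Type*} {c : P → ℤ} (hc : ∀ p, c p = 1 ∨ c p = -1) {ε : ℤ}
    (hε : ε = 1 ∨ ε = -1) (s : Finset P) :
    2 * ((s.filter fun p => c p = ε).card : ℤ) = s.card + ε * ∑ p ∈ s, c p := by
  rw [Finset.card_filter, Finset.card_eq_sum_ones, Finset.mul_sum]
  push_cast
  rw [Finset.mul_sum, ← Finset.sum_add_distrib]
  refine Finset.sum_congr rfl fun p _ => ?_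
  rcases hc p with h | h <;> rcases hε with h' | h' <;> simp [h, h']

/-! ### Allowable sequences and levels of cuts -/

/-- A periodic sequence of orderings of a finite type, consecutive ones differing by a swap of
neighbours, which is reversed after `M` steps. -/
structure AllowableSequence (P : Type*) [Fintype P] (M : ℤ) where
  /-- the position of an element at a given time -/
  pos : ℤ → P → ℤ
  inj : ∀ t, Function.Injective (pos t)
  one_le : ∀ t p, 1 ≤ pos t p
  le_card : ∀ t p, pos t p ≤ Fintype.card P
  swap : ∀ t, ∃ a b, pos t b = pos t a + 1 ∧ pos (t + 1) a = pos t b ∧ pos (t + 1) b = pos t a ∧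
    ∀ p, p ≠ a → p ≠ b → pos (t + 1) p = pos t p
  anti : ∀ t p, pos (t + M) p = Fintype.card P + 1 - pos t p

namespace AllowableSequence

variable {P : Type*} [Fintype P] {M : ℤ} (S : AllowableSequence P M)

/-- The elements in the first `j` positions. -/
def initial (t j : ℤ) : Finset P := Finset.univ.filter fun p => S.pos t p ≤ j

/-- The weight of the first `j` positions minus `d`, where the positions outside `[1, n]` are
considered to carry weight `1`. -/
def level (c : P → ℤ) (d t j : ℤ) : ℤ :=
  ∑ p ∈ S.initial t j, c p + min j 0 + max (j - Fintype.card P) 0 - d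

@[simp] lemma mem_initial {t j : ℤ} {p : P} : p ∈ S.initial t j ↔ S.pos t p ≤ j := by
  simp [initial]

lemma exists_pos_eq (t : ℤ) {j : ℤ} (h1 : 1 ≤ j) (h2 : j ≤ Fintype.card P) :
    ∃ p, S.pos t p = j := by
  classical
  have h : Finset.univ.image (S.pos t) = Finset.Icc 1 (Fintype.card P : ℤ) := by
    apply Finset.eq_of_subset_of_card_le
    · intro x hx
      obtain ⟨p, -, rfl⟩ := Finset.mem_image.1 hx
      exact Finset.mem_Icc.2 ⟨S.one_le t p, S.le_card t p⟩
    · rw [Finset.card_image_of_injective _ (S.inj t)]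
      simp
  have hj : j ∈ Finset.univ.image (S.pos t) := by rw [h]; exact Finset.mem_Icc.2 ⟨h1, h2⟩
  obtain ⟨p, -, hp⟩ := Finset.mem_image.1 hj
  exact ⟨p, hp⟩

lemma initial_add_one [DecidableEq P] {t j : ℤ} {p : P} (hp : S.pos t p = j + 1) :
    S.initial t (j + 1) = insert p (S.initial t j) := by
  ext q
  simp only [mem_initial, Finset.mem_insert]
  constructor
  · intro hq
    by_cases h : S.pos t q = j + 1
    · left; exact S.inj t (h.trans hp.symm)
    · right; omega
  · rintro (rfl | hq) <;> omega

lemma initial_of_nonpos {t j : ℤ} (hj : j ≤ 0) : S.initial t j = ∅ := by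
  ext q
  have := S.one_le t q
  simp only [mem_initial, Finset.notMem_empty, iff_false]
  omega

lemma initial_of_card_le {t j : ℤ} (hj : (Fintype.card P : ℤ) ≤ j) :
    S.initial t j = Finset.univ := by
  ext q
  have := S.le_card t q
  simp only [mem_initial, Finset.mem_univ, iff_true]
  omega

lemma level_add_one_of_pos (c : P → ℤ) (d : ℤ) {t j : ℤ} {p : P} (hp : S.pos t p = j + 1) :
    S.level c d t (j + 1) = S.level c d t j + c p := by
  have h1 := S.one_le t p
  have h2 := S.le_card t p
  classical
  unfold level
  rw [S.initial_add_one hp, Finset.sum_insert (by simp [hp])]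
  omega

lemma level_of_nonpos (c : P → ℤ) (d : ℤ) {t j : ℤ} (hj : j ≤ 0) :
    S.level c d t j = j - d := by
  unfold level
  rw [S.initial_of_nonpos hj, Finset.sum_empty]
  omega

lemma level_add_one {c : P → ℤ} (hc : ∀ p, c p = 1 ∨ c p = -1) (d t j : ℤ) :
    S.level c d t (j + 1) = S.level c d t j + 1 ∨ S.level c d t (j + 1) = S.level c d t j - 1 := by
  by_cases h1 : 1 ≤ j + 1
  · by_cases h2 : j + 1 ≤ Fintype.card P
    · obtain ⟨p, hp⟩ := S.exists_pos_eq t h1 h2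
      rw [S.level_add_one_of_pos c d hp]
      rcases hc p with h | h <;> rw [h] <;> omega
    · left
      unfold level
      rw [S.initial_of_card_le (by omega), S.initial_of_card_le (by omega)]
      omega
  · left
    rw [S.level_of_nonpos c d (by omega), S.level_of_nonpos c d (by omega)]
    omega

lemma initial_swap {t j : ℤ} {a b : P} (h1 : S.pos t b = S.pos t a + 1)
    (h2 : S.pos (t + 1) a = S.pos t b) (h3 : S.pos (t + 1) b = S.pos t a)
    (h4 : ∀ p, p ≠ a → p ≠ b → S.pos (t + 1) p = S.pos t p) (hj : j ≠ S.pos t a) :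
    S.initial (t + 1) j = S.initial t j := by
  ext p
  simp only [mem_initial]
  by_cases ha : p = a
  · subst ha; omega
  · by_cases hb : p = b
    · subst hb; omega
    · rw [h4 p ha hb]

lemma level_swap (c : P → ℤ) (d : ℤ) {t j : ℤ} {a b : P} (h1 : S.pos t b = S.pos t a + 1)
    (h2 : S.pos (t + 1) a = S.pos t b) (h3 : S.pos (t + 1) b = S.pos t a)
    (h4 : ∀ p, p ≠ a → p ≠ b → S.pos (t + 1) p = S.pos t p) (hj : j ≠ S.pos t a) :
    S.level c d (t + 1) j = S.level c d t j := by
  unfold level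
  rw [S.initial_swap h1 h2 h3 h4 hj]

lemma initial_anti [DecidableEq P] (t j : ℤ) :
    S.initial (t + M) (Fintype.card P - j) = (S.initial t j)ᶜ := by
  ext p
  rw [Finset.mem_compl]
  simp only [mem_initial, S.anti]
  omega

lemma level_anti {c : P → ℤ} {d : ℤ} (hd : ∑ p, c p = 2 * d) (t j : ℤ) :
    S.level c d (t + M) (Fintype.card P - j) = -S.level c d t j := by
  classical
  have := Finset.sum_compl_add_sum (S.initial t j) c
  unfold level
  rw [S.initial_anti]
  omega

/-- Equality holds for `j ≤ 0`, and from there on each step adds at most one. This makes the low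
rows negative and keeps zero vertices within range. -/
lemma level_le {c : P → ℤ} (hc : ∀ p, c p = 1 ∨ c p = -1) (d t : ℤ) {j : ℤ} :
    S.level c d t j ≤ j - d := by
  by_cases hj : j ≤ 0
  · exact (S.level_of_nonpos c d hj).le
  · obtain ⟨n, rfl⟩ := Int.eq_ofNat_of_zero_le (by omega : 0 ≤ j)
    clear hj
    induction n with
    | zero => exact (S.level_of_nonpos c d (by simp)).le
    | succ n ih =>
      have := S.level_add_one hc d t n
      push_cast
      omega

/-- By parity the level is odd, hence nonzero, at the cuts `d + 2 * i - 1` carrying the cells; it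
can vanish at the cuts `d + 2 * v` carrying the vertices. -/
lemma even_level_add {c : P → ℤ} (hc : ∀ p, c p = 1 ∨ c p = -1) (d t j : ℤ) :
    Even (S.level c d t j + j + d) := by
  induction j using Int.induction_on with
  | zero => rw [S.level_of_nonpos c d le_rfl]; simp
  | succ j ih =>
    rcases S.level_add_one hc d t j with h | h <;> rw [h] <;> grind
  | pred j ih =>
    have := S.level_add_one hc d t (-j - 1)
    rw [show -(j : ℤ) - 1 + 1 = -j by ring] at this
    grind

/-- An element that crosses the cut `j` sits right next to it after the swap, so its weight is an
adjacent increment of the level. -/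
lemma weight_of_mem_ne (c : P → ℤ) (d : ℤ) {t j : ℤ} {p : P}
    (hp : ¬ (S.pos t p ≤ j ↔ S.pos (t + 1) p ≤ j)) :
    c p = S.level c d (t + 1) (j + 1) - S.level c d (t + 1) j ∨
      c p = S.level c d (t + 1) j - S.level c d (t + 1) (j - 1) := by
  obtain ⟨a, b, h1, h2, h3, h4⟩ := S.swap t
  have h5 : S.pos (t + 1) p = j + 1 ∨ S.pos (t + 1) p = j := by
    by_cases ha : p = a
    · subst ha; omega
    · by_cases hb : p = b
      · subst hb; omega
      · rw [h4 p ha hb] at hp; simp at hp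
  rcases h5 with h | h
  · left
    rw [S.level_add_one_of_pos c d h]; ring
  · right
    have := S.level_add_one_of_pos c d (t := t + 1) (j := j - 1) (p := p) (by omega)
    rw [sub_add_cancel] at this
    rw [this]; ring

/-! ### The region of negative level -/

/-- The cells `(t, i)` with negative level. -/
def negRegion (c : P → ℤ) (d t i : ℤ) : Bool := decide (S.level c d t (d + 2 * i - 1) < 0)

lemma negRegion_eq_true {c : P → ℤ} {d t i : ℤ} :
    S.negRegion c d t i = true ↔ S.level c d t (d + 2 * i - 1) < 0 := by simp [negRegion]

lemma negRegion_eq_false {c : P → ℤ} (hc : ∀ p, c p = 1 ∨ c p = -1) {d t i : ℤ} :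
    S.negRegion c d t i = false ↔ 0 < S.level c d t (d + 2 * i - 1) := by
  have := S.even_level_add hc d t (d + 2 * i - 1)
  simp only [negRegion, decide_eq_false_iff_not]
  grind

lemma eq_of_negRegion_ne {c : P → ℤ} (d : ℤ) {t i : ℤ} {a b : P}
    (h1 : S.pos t b = S.pos t a + 1)
    (h2 : S.pos (t + 1) a = S.pos t b) (h3 : S.pos (t + 1) b = S.pos t a)
    (h4 : ∀ p, p ≠ a → p ≠ b → S.pos (t + 1) p = S.pos t p)
    (hi : S.negRegion c d t i ≠ S.negRegion c d (t + 1) i) : d + 2 * i - 1 = S.pos t a := by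
  by_contra hcon
  apply hi
  unfold negRegion
  rw [S.level_swap c d h1 h2 h3 h4 hcon]

lemma glideColoring {c : P → ℤ} (hc : ∀ p, c p = 1 ∨ c p = -1) {d r : ℤ}
    (hd : ∑ p, c p = 2 * d) (hn : (Fintype.card P : ℤ) = 2 * r + 2 * d) :
    GlideColoring (S.negRegion c d) M r := by
  have hanti : ∀ t i, S.negRegion c d (t + M) (r + 1 - i) = !S.negRegion c d t i := by
    intro t i
    have h1 := S.level_anti hd t (d + 2 * i - 1)
    rw [show (Fintype.card P : ℤ) - (d + 2 * i - 1) = d + 2 * (r + 1 - i) - 1 by rw [hn]; ring]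
      at h1
    have h2 := S.negRegion_eq_true (c := c) (d := d) (t := t + M) (i := r + 1 - i)
    have h3 := S.negRegion_eq_true (c := c) (d := d) (t := t) (i := i)
    have h4 := S.negRegion_eq_false hc (d := d) (t := t) (i := i)
    rw [h1] at h2
    cases h5 : S.negRegion c d t i
    · rw [h5] at h4; simp only [true_iff] at h4; simp [h2, h4]
    · rw [h5] at h3; simp only [true_iff] at h3
      rw [Bool.not_true, ← Bool.not_eq_true, h2]; omega
  have hlow : ∀ s i, i ≤ 0 → S.negRegion c d s i = true := by
    intro s i hi
    rw [negRegion_eq_true]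
    have := S.level_le hc d s (j := d + 2 * i - 1)
    omega
  refine ⟨?_, hlow, ?_, hanti⟩
  · intro t i i' hi hi'
    obtain ⟨a, b, h1, h2, h3, h4⟩ := S.swap t
    have h5 := S.eq_of_negRegion_ne d h1 h2 h3 h4 hi
    have h6 := S.eq_of_negRegion_ne d h1 h2 h3 h4 hi'
    omega
  · intro s i hi
    have := hanti s i
    rw [hlow _ _ (by omega)] at this
    simpa using this.symm

/-- A change of cells comes from a swap of elements of different colors with balanced sides. -/
lemma balanced_of_negRegion_ne {c : P → ℤ} (hc : ∀ p, c p = 1 ∨ c p = -1) {d t i : ℤ}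
    (hi : S.negRegion c d t i ≠ S.negRegion c d (t + 1) i) :
    ∃ a b, S.pos t b = S.pos t a + 1 ∧ S.pos (t + 1) a = S.pos t b ∧ c b = -c a ∧
      ∑ p with S.pos t p < S.pos t a, c p = d := by
  obtain ⟨a, b, h1, h2, h3, h4⟩ := S.swap t
  refine ⟨a, b, h1, h2, ?_⟩
  have hk := S.eq_of_negRegion_ne d h1 h2 h3 h4 hi
  set k := S.pos t a with hkdef
  have u1 := S.level_swap c d h1 h2 h3 h4 (j := k - 1) (by omega)
  have u2 := S.level_swap c d h1 h2 h3 h4 (j := k + 1) (by omega)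
  have w1 := S.level_add_one hc d t (k - 1)
  have w2 := S.level_add_one hc d (t + 1) (k - 1)
  have v1 := S.level_add_one_of_pos c d (t := t) (j := k - 1) (p := a) (by omega)
  have v2 := S.level_add_one_of_pos c d (t := t) (j := k) (p := b) (by omega)
  have w3 := S.level_add_one hc d (t + 1) k
  rw [sub_add_cancel] at w1 w2 v1
  have x1 := S.negRegion_eq_true (c := c) (d := d) (t := t) (i := i)
  have x2 := S.negRegion_eq_false hc (d := d) (t := t) (i := i)
  have x3 := S.negRegion_eq_true (c := c) (d := d) (t := t + 1) (i := i)
  have x4 := S.negRegion_eq_false hc (d := d) (t := t + 1) (i := i)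
  rw [hk] at x1 x2 x3 x4
  -- The levels at `k - 1` and `k + 1` survive the swap and differ by one from the level at `k` both
  -- before and after. These two have opposite signs, so both neighbouring levels vanish and the two
  -- weights cancel.
  have hz : S.level c d t (k - 1) = 0 ∧ c b = - c a := by
    grind
  refine ⟨hz.2, ?_⟩
  have hz1 := hz.1
  have := S.one_le t a
  have := S.le_card t a
  unfold level at hz1
  have e : (Finset.univ.filter fun p => S.pos t p < k) = S.initial t (k - 1) := by
    ext p; simp
  rw [e]
  omega

/-- A boundary edge at the vertex separates cells of opposite signs. If it is horizontal, the level
passes through zero between them; if it is vertical, the level next to a flipping one is unchanged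
and within one of both signs. -/
lemma boundaryStep_negRegion {c : P → ℤ} (hc : ∀ p, c p = 1 ∨ c p = -1) {d t v : ℤ}
    (hv : boundaryStep (S.negRegion c d) (t, v) ≠ (t, v)) : S.level c d t (d + 2 * v) = 0 := by
  obtain ⟨a, b, h1, h2, h3, h4⟩ := S.swap t
  have w1 := S.level_add_one hc d t (d + 2 * v - 1)
  have w2 := S.level_add_one hc d t (d + 2 * v)
  have w3 := S.level_add_one hc d (t + 1) (d + 2 * v - 1)
  have w4 := S.level_add_one hc d (t + 1) (d + 2 * v)
  rw [sub_add_cancel] at w1 w3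
  have u1 := S.level_swap c d h1 h2 h3 h4 (j := d + 2 * v)
  have u2 := S.level_swap c d h1 h2 h3 h4 (j := d + 2 * v - 1)
  have u3 := S.level_swap c d h1 h2 h3 h4 (j := d + 2 * v + 1)
  have e : d + 2 * (v + 1) - 1 = d + 2 * v + 1 := by ring
  have x1 := S.negRegion_eq_true (c := c) (d := d) (t := t) (i := v)
  have x2 := S.negRegion_eq_false hc (d := d) (t := t) (i := v)
  have x3 := S.negRegion_eq_true (c := c) (d := d) (t := t + 1) (i := v)
  have x4 := S.negRegion_eq_false hc (d := d) (t := t + 1) (i := v)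
  have y1 := S.negRegion_eq_true (c := c) (d := d) (t := t) (i := v + 1)
  have y2 := S.negRegion_eq_false hc (d := d) (t := t) (i := v + 1)
  have y3 := S.negRegion_eq_true (c := c) (d := d) (t := t + 1) (i := v + 1)
  have y4 := S.negRegion_eq_false hc (d := d) (t := t + 1) (i := v + 1)
  rw [e] at y1 y2 y3 y4
  unfold boundaryStep at hv
  dsimp only at hv
  generalize S.negRegion c d t v = n1 at *
  generalize S.negRegion c d t (v + 1) = n2 at *
  generalize S.negRegion c d (t + 1) v = n3 at *
  generalize S.negRegion c d (t + 1) (v + 1) = n4 at *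
  cases n1 <;> cases n2 <;> cases n3 <;> cases n4 <;>
    simp only [true_iff, Bool.not_true, Bool.not_false, Bool.and_true,
      Bool.and_false, if_true, ne_eq, not_true, reduceCtorEq, if_false, false_iff] at * <;>
    omega

/-! ### Color classes along the walk -/

lemma card_initial (t : ℤ) {j : ℤ} (h0 : 0 ≤ j) (hj : j ≤ Fintype.card P) :
    ((S.initial t j).card : ℤ) = j := by
  classical
  obtain ⟨n, rfl⟩ := Int.eq_ofNat_of_zero_le h0
  clear h0
  induction n with
  | zero => rw [S.initial_of_nonpos (by simp)]; simp
  | succ n ih =>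
    push_cast at hj
    obtain ⟨p, hp⟩ := S.exists_pos_eq t (j := n + 1) (by omega) hj
    push_cast
    rw [S.initial_add_one hp, Finset.card_insert_of_notMem (by simp [hp])]
    push_cast
    rw [ih (by omega)]

/-- The elements of color `ε` before the vertex `(t, v)`. -/
def colorInitial (c : P → ℤ) (d ε t v : ℤ) : Finset P :=
  (S.initial t (d + 2 * v)).filter fun p => c p = ε

/-- At a zero vertex both the size `d + 2 * v` and the weight `d` of the initial segment are known.
`level_le` at the vertex and at its antipode shows that the cut lies in range. -/
lemma two_mul_card_colorInitial {c : P → ℤ} (hc : ∀ p, c p = 1 ∨ c p = -1) {d ε t v : ℤ}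
    (hε : ε = 1 ∨ ε = -1) (hd0 : 0 ≤ d) (hd : ∑ p, c p = 2 * d)
    (hz : S.level c d t (d + 2 * v) = 0) :
    2 * ((S.colorInitial c d ε t v).card : ℤ) = d + 2 * v + ε * d := by
  have h1 := S.level_le hc d t (j := d + 2 * v)
  have h2 := S.level_le hc d (t + M) (j := Fintype.card P - (d + 2 * v))
  rw [S.level_anti hd] at h2
  have h0 : 0 ≤ d + 2 * v := by omega
  have h0' : d + 2 * v ≤ Fintype.card P := by omega
  have h3 := S.card_initial t h0 h0'
  have h4 : ∑ p ∈ S.initial t (d + 2 * v), c p = d := by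
    unfold level at hz; omega
  rw [colorInitial, two_mul_card_filter hc hε, h3, h4]

/-- At a fixed time the initial segments are nested, and between zero vertices each row adds one
element of either color. -/
lemma card_symmDiff_colorInitial [DecidableEq P] {c : P → ℤ} (hc : ∀ p, c p = 1 ∨ c p = -1)
    {d ε t v v' : ℤ} (hε : ε = 1 ∨ ε = -1) (hd0 : 0 ≤ d) (hd : ∑ p, c p = 2 * d)
    (hz : S.level c d t (d + 2 * v) = 0) (hz' : S.level c d t (d + 2 * v') = 0) :
    (symmDiff (S.colorInitial c d ε t v) (S.colorInitial c d ε t v')).card =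
      (v' - v).natAbs := by
  wlog h : v ≤ v' generalizing v v'
  · rw [symmDiff_comm, this hz' hz (by omega)]; omega
  have hsub : S.colorInitial c d ε t v ⊆ S.colorInitial c d ε t v' := by
    intro p hp
    simp only [colorInitial, Finset.mem_filter, mem_initial] at hp ⊢
    exact ⟨by omega, hp.2⟩
  have h1 := S.two_mul_card_colorInitial hc hε hd0 hd hz
  have h2 := S.two_mul_card_colorInitial hc hε hd0 hd hz'
  rw [symmDiff_of_le hsub, Finset.card_sdiff_of_subset hsub]
  omega

/-- The level changes sign monotonically across the cut, so both elements adjacent to the cut have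
color `-ε`, and only such elements can have crossed it. -/
lemma colorInitial_eq {c : P → ℤ} (hc : ∀ p, c p = 1 ∨ c p = -1) {d ε t v : ℤ}
    (h1 : 0 < ε * S.level c d (t + 1) (d + 2 * v - 1))
    (h2 : ε * S.level c d (t + 1) (d + 2 * v + 1) < 0) (hε : ε = 1 ∨ ε = -1) :
    S.colorInitial c d ε (t + 1) v = S.colorInitial c d ε t v := by
  have w3 := S.level_add_one hc d (t + 1) (d + 2 * v - 1)
  have w4 := S.level_add_one hc d (t + 1) (d + 2 * v)
  rw [sub_add_cancel] at w3
  ext p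
  simp only [colorInitial, Finset.mem_filter, mem_initial, and_congr_left_iff]
  intro hp
  by_contra hcon
  have := S.weight_of_mem_ne c d (t := t) (j := d + 2 * v) (p := p) (fun h => hcon h.symm)
  rcases hε with rfl | rfl <;> omega

lemma pos_add_odd_mul (t : ℤ) (p : P) {w : ℤ} (hw : Odd w) :
    S.pos (t + w * M) p = Fintype.card P + 1 - S.pos t p := by
  obtain ⟨k, rfl⟩ := hw
  have h2 : ∀ t, S.pos (t + M + M) p = S.pos t p := fun t => by rw [S.anti, S.anti]; ring
  induction k using Int.induction_on with
  | zero => rw [← S.anti]; congr 1; ring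
  | succ k ih =>
    rw [← ih, show t + (2 * ((k : ℤ) + 1) + 1) * M = t + (2 * (k : ℤ) + 1) * M + M + M by ring, h2]
  | pred k ih =>
    rw [← ih, show t + (2 * (-(k : ℤ)) + 1) * M = t + (2 * (-(k : ℤ) - 1) + 1) * M + M + M by ring,
      h2]

/-- A walk on zero vertices, which only moves forward in time where the color `ε` is not affected,
to an antipode of its start has at least as many vertical steps as there are elements of
color `ε`. -/
lemma card_color_le_of_walk {c : P → ℤ} (hc : ∀ p, c p = 1 ∨ c p = -1) {d ε r : ℤ}
    (hε : ε = 1 ∨ ε = -1) (hd0 : 0 ≤ d) (hd : ∑ p, c p = 2 * d)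
    (hn : (Fintype.card P : ℤ) = 2 * r + 2 * d) (z : ℕ → ℤ × ℤ) (m : ℕ) (w : ℤ) (hw : Odd w)
    (hw0 : 0 ≤ w * M) (hz : ∀ i ≤ m, S.level c d (z i).1 (d + 2 * (z i).2) = 0)
    (hend : z m = ((z 0).1 + w * M, r - (z 0).2))
    (hstep : ∀ i < m, (z (i + 1)).1 ≤ (z i).1 + 1)
    (hfwd : ∀ i < m, (z (i + 1)).1 = (z i).1 + 1 → (z (i + 1)).2 = (z i).2 ∧
      0 < ε * S.level c d (z (i + 1)).1 (d + 2 * (z i).2 - 1) ∧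
      ε * S.level c d (z (i + 1)).1 (d + 2 * (z i).2 + 1) < 0) :
    (Finset.univ.filter fun p => c p = ε).card ≤
      ∑ i ∈ Finset.range m, ((z (i + 1)).2 - (z i).2).natAbs := by
  classical
  have key := card_symmDiff_le_of_walk (τ := fun i => (z i).1)
    (A := fun i => S.colorInitial c d ε (z i).1 (z i).2)
    (E := fun i => ((z (i + 1)).2 - (z i).2).natAbs) (m := m) hstep ?_ ?_ 0 m (Nat.zero_le m) le_rfl
    (by rw [hend]; dsimp only; omega)
  · rw [Finset.range_eq_Ico]
    refine le_trans (Finset.card_le_card ?_) key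
    intro p hp
    rw [Finset.mem_filter] at hp
    -- After an odd number of reversals the cut `d + 2 * (r - v)` has before it exactly the elements
    -- that were after the cut `d + 2 * v`, so every element of color `ε` has switched sides.
    rw [Finset.mem_symmDiff, hend]
    simp only [colorInitial, Finset.mem_filter, mem_initial, S.pos_add_odd_mul _ _ hw, hp.2, and_true]
    omega
  · intro i hi h
    obtain ⟨h1, h2, h3⟩ := hfwd i hi h
    rw [h] at h2 h3
    simp only [h, h1]
    exact S.colorInitial_eq hc h2 h3 hε
  · intro i j hij hj h
    rw [← h, S.card_symmDiff_colorInitial hc hε hd0 hd (hz i (by omega)) (by rw [h]; exact hz j hj)]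
    clear h hj
    induction j, hij using Nat.le_induction with
    | base => simp
    | succ j hij ih => rw [Finset.sum_Ico_succ_top hij]; omega

open Classical in
/-- The number of balanced bichromatic swaps in an allowable sequence is at least the size of the
smaller color class. -/
theorem le_card_balanced {c : P → ℤ} (hc : ∀ p, c p = 1 ∨ c p = -1) {d r : ℤ} (hd0 : 0 ≤ d)
    (hr : 0 ≤ r) (hd : ∑ p, c p = 2 * d)
    (hn : (Fintype.card P : ℤ) = 2 * r + 2 * d) (hM : 0 < M) :
    r ≤ ((Finset.Ico 0 M).filter fun t => ∃ a b, S.pos t b = S.pos t a + 1 ∧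
      S.pos (t + 1) a = S.pos t b ∧ c b = -c a ∧
      ∑ p with S.pos t p < S.pos t a, c p = d).card := by
  have hG := S.glideColoring hc hd hn
  obtain ⟨y, m, w, hy, hne, hw, hend, hcard⟩ := hG.exists_odd_walk hM hr
  have hcard' := hcard.trans (Finset.card_le_card (Finset.monotone_filter_right _
    fun t _ ⟨i, hi⟩ => S.balanced_of_negRegion_ne hc hi))
  have hz : ∀ i, S.level c d (y i).1 (d + 2 * (y i).2) = 0 := fun i =>
    S.boundaryStep_negRegion hc (by rw [Prod.mk.eta, ← hy]; exact hne i)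
  have hsum : ∑ i ∈ Finset.range m, ((y (i + 1)).2 - (y i).2).natAbs ≤
      ((Finset.range m).filter fun i => (y (i + 1)).2 ≠ (y i).2).card := by
    rw [Finset.card_filter]
    refine Finset.sum_le_sum fun i _ => ?_
    have := boundaryStep_snd (S.negRegion c d) (y i)
    rw [← hy] at this
    split_ifs <;> omega
  have hcol : ∀ {ε : ℤ}, (ε = 1 ∨ ε = -1) →
      r ≤ (Finset.univ.filter fun p => c p = ε).card := by
    intro ε hε
    have := two_mul_card_filter hc hε Finset.univ
    rw [hd, Finset.card_univ] at this
    rcases hε with rfl | rfl <;> omega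
  rcases le_total 0 (w * M) with hw0 | hw0
  -- On a step to the right the negative cell is below and the level increases through the cut: only
  -- elements of weight `1` cross, so weight `-1` is followed.
  · have := S.card_color_le_of_walk hc (Or.inr rfl) hd0 hd hn y m w hw hw0 (fun i _ => hz i) hend
      (fun i _ => by have := boundaryStep_fst (S.negRegion c d) (y i); rw [← hy] at this; omega)
      (fun i _ h => by
        have h1 : (y (i + 1)).2 = (y i).2 := by
          rw [hy] at h ⊢; exact boundaryStep_snd_of_fst_ne (by omega)
        have h2 := h
        rw [hy, boundaryStep_fst_eq_add_one, ← h, S.negRegion_eq_true, S.negRegion_eq_false hc,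
          show d + 2 * ((y i).2 + 1) - 1 = d + 2 * (y i).2 + 1 by ring] at h2
        exact ⟨h1, by omega, by omega⟩)
    have := hcol (Or.inr rfl)
    omega
  -- Reversed in time, the forward steps are former steps to the left, with the negative cell above.
  -- The roles of the colors are exchanged, and the class of weight `1` also has at least `r`
  -- elements.
  · have := S.card_color_le_of_walk hc (Or.inl rfl) hd0 hd hn (fun i => y (m - i)) m (-w) hw.neg
      (by linarith) (fun i _ => hz _)
      (by simp only [Nat.sub_self, Nat.sub_zero, hend]; ext <;> simp)
      (fun i hi => by
        have := boundaryStep_fst (S.negRegion c d) (y (m - (i + 1)))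
        rw [← hy, show m - (i + 1) + 1 = m - i by omega] at this; omega)
      (fun i hi h => by
        have e : m - (i + 1) + 1 = m - i := by omega
        have h0 := hy (m - (i + 1))
        rw [e] at h0
        rw [h0] at h ⊢
        have h1 := boundaryStep_snd_of_fst_ne (N := S.negRegion c d) (x := y (m - (i + 1))) (by omega)
        have h2 := (boundaryStep_fst_eq_sub_one hG.oneFlip).1 (by omega :
          (boundaryStep (S.negRegion c d) (y (m - (i + 1)))).1 = (y (m - (i + 1))).1 - 1)
        rw [S.negRegion_eq_true, S.negRegion_eq_false hc,
          show d + 2 * ((y (m - (i + 1))).2 + 1) - 1 = d + 2 * (y (m - (i + 1))).2 + 1 by ring] at h2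
        rw [h1]
        exact ⟨rfl, by omega, by omega⟩)
    have h2 := hcol (Or.inl rfl)
    have h3 : ∑ i ∈ Finset.range m, ((y (m - (i + 1))).2 - (y (m - i)).2).natAbs =
        ∑ i ∈ Finset.range m, ((y (i + 1)).2 - (y i).2).natAbs := by
      rw [← Finset.sum_range_reflect]
      refine Finset.sum_congr rfl fun i hi => ?_
      rw [Finset.mem_range] at hi
      rw [show m - (m - 1 - i + 1) = i by omega, show m - (m - 1 - i) = i + 1 by omega]
      omega
    omega

end AllowableSequence

/-! ### Ranking the pairs of points by slope -/

/-- The slope of the line through the points with coordinates `(u p, v p)` and `(u q, v q)`. -/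
noncomputable def slopeOf {P : Type*} (u v : P → ℝ) (p q : P) : ℝ := (v q - v p) / (u q - u p)

/-- The position of `q` relative to the line through `a` and `b`; it is negative if `q` is below
the line and `u a < u b`. -/
def sideOf {P : Type*} (u v : P → ℝ) (a b q : P) : ℝ :=
  (v q - v a) * (u b - u a) - (v b - v a) * (u q - u a)

/-- A ranking of the pairs of points by the slopes of their lines. -/
structure SlopeRank {P : Type*} (u v : P → ℝ) (M : ℤ) where
  /-- the rank of a pair -/
  rank : P → P → ℤ
  symm : ∀ p q, rank p q = rank q p
  nonneg : ∀ p q, 0 ≤ rank p q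
  lt : ∀ p q, p ≠ q → rank p q < M
  mono : ∀ p q p' q', p ≠ q → p' ≠ q' → slopeOf u v p q < slopeOf u v p' q' →
    rank p q < rank p' q'
  inj : ∀ p q p' q', u p < u q → u p' < u q' → rank p q = rank p' q' → p = p' ∧ q = q'
  surj : ∀ s, 0 ≤ s → s < M → ∃ p q, u p < u q ∧ rank p q = s

lemma slopeOf_comm {P : Type*} (u v : P → ℝ) (p q : P) : slopeOf u v p q = slopeOf u v q p := by
  unfold slopeOf
  rw [← neg_div_neg_eq]; congr 1 <;> ring

lemma exists_slopeRank {P : Type*} [Fintype P] {u : P → ℝ} (v : P → ℝ)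
    (hu : Function.Injective u) : ∃ M : ℤ, 0 ≤ M ∧ Nonempty (SlopeRank u v M) := by
  classical
  let Q := {x : P × P // u x.1 < u x.2}
  let f : Q → ℝ := fun x => slopeOf u v x.1.1 x.1.2
  let e₀ := Fintype.equivFin Q
  -- Parallel pairs are ranked in an arbitrary order; only strict comparisons of slopes are used
  -- later.
  let σ := Tuple.sort (f ∘ e₀.symm)
  have hσ : Monotone ((f ∘ e₀.symm) ∘ σ) := Tuple.monotone_sort _
  let e : Q ≃ Fin (Fintype.card Q) := e₀.trans σ.symm
  have he : ∀ x y : Q, f x < f y → e x < e y := by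
    intro x y hxy
    by_contra hcon
    have := hσ (not_lt.1 hcon)
    simp [e] at this
    exact absurd hxy (not_lt.2 this)
  let rk : P → P → ℤ := fun p q =>
    if h : u p < u q then ((e ⟨(p, q), h⟩ : Fin _) : ℕ) else
    if h : u q < u p then ((e ⟨(q, p), h⟩ : Fin _) : ℕ) else 0
  have hrk : ∀ p q (h : u p < u q), rk p q = ((e ⟨(p, q), h⟩ : Fin _) : ℕ) :=
    fun p q h => by simp only [rk, dif_pos h]
  have hsymm : ∀ p q, rk p q = rk q p := by
    intro p q
    simp only [rk]
    split_ifs with h1 h2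
    · exact absurd h1 (lt_asymm h2)
    · rfl
    · rfl
    · rfl
  have hne : ∀ p q, p ≠ q → ∃ x : Q, rk p q = ((e x : Fin _) : ℕ) ∧ f x = slopeOf u v p q := by
    intro p q hpq
    rcases lt_or_gt_of_ne (hu.ne hpq) with h | h
    · exact ⟨⟨(p, q), h⟩, hrk p q h, rfl⟩
    · exact ⟨⟨(q, p), h⟩, by rw [hsymm, hrk q p h], slopeOf_comm u v q p⟩
  refine ⟨Fintype.card Q, by positivity, ⟨⟨rk, hsymm, ?_, ?_, ?_, ?_, ?_⟩⟩⟩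
  · intro p q
    simp only [rk]
    split_ifs <;> positivity
  · intro p q hpq
    obtain ⟨x, hx, -⟩ := hne p q hpq
    rw [hx]
    exact_mod_cast (e x).2
  · intro p q p' q' h h' hlt
    obtain ⟨x, hx, hfx⟩ := hne p q h
    obtain ⟨y, hy, hfy⟩ := hne p' q' h'
    rw [hx, hy]
    exact_mod_cast he x y (by rw [hfx, hfy]; exact hlt)
  · intro p q p' q' h h' heq
    rw [hrk p q h, hrk p' q' h'] at heq
    have := e.injective (Fin.ext (by exact_mod_cast heq))
    exact ⟨congrArg (fun x : Q => x.1.1) this, congrArg (fun x : Q => x.1.2) this⟩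
  · intro s h0 h1
    obtain ⟨k, rfl⟩ := Int.eq_ofNat_of_zero_le h0
    obtain ⟨⟨⟨p, q⟩, hx⟩, hx'⟩ := e.surjective ⟨k, by exact_mod_cast h1⟩
    exact ⟨p, q, hx, by rw [hrk p q hx, hx']⟩

/-! ### The orders of the points and their allowable sequence -/

/-- No three points are collinear. -/
def NoThreeCollinear {P : Type*} (u v : P → ℝ) : Prop :=
  ∀ a b q, a ≠ b → q ≠ a → q ≠ b → sideOf u v a b q ≠ 0

namespace SlopeRank

variable {P : Type*} {u v : P → ℝ} {M : ℤ} (S : SlopeRank u v M)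

/-- The order of the points after the pairs of rank less than `s` have been reversed. -/
def before (s : ℤ) (p q : P) : Prop :=
  (s ≤ S.rank p q ∧ u p < u q) ∨ (S.rank p q < s ∧ u q < u p)

lemma before_asymm {s : ℤ} {p q : P} (h : S.before s p q) : ¬ S.before s q p := by
  unfold before at *
  rw [S.symm q p]
  rcases h with h | h <;> rintro (h' | h') <;> first | omega | exact lt_asymm h.2 h'.2

lemma before_irrefl (s : ℤ) (p : P) : ¬ S.before s p p := fun h => S.before_asymm h h

lemma before_total (hu : Function.Injective u) (s : ℤ) {p q : P} (h : p ≠ q) :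
    S.before s p q ∨ S.before s q p := by
  unfold before
  rw [S.symm q p]
  have := lt_or_gt_of_ne (hu.ne h)
  have := lt_or_ge (S.rank p q) s
  tauto

/-- The side of a third point is read off from the order at the time when a pair is swapped. -/
lemma before_left_iff (hg : NoThreeCollinear u v) (hu : Function.Injective u) {a b q : P}
    (hab : u a < u b) : S.before (S.rank a b) q a ↔ sideOf u v a b q < 0 := by
  by_cases hqa : q = a
  · subst hqa
    simp [S.before_irrefl, sideOf]
  by_cases hqb : q = b
  · subst hqb
    simp [before, sideOf, hab.le, S.symm q a, mul_comm]
  have hne : a ≠ b := fun h => by rw [h] at hab; exact lt_irrefl _ hab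
  -- General position makes the slopes of `ab` and `aq` different, so the tie-breaking cannot
  -- interfere.
  have h0 := hg a b q hne hqa hqb
  have hm1 := S.mono a b q a hne hqa
  have hm2 := S.mono q a a b hqa hne
  have hpos : 0 < u b - u a := sub_pos.2 hab
  rcases lt_or_gt_of_ne (hu.ne hqa) with h | h
  · have hpos' : 0 < u a - u q := sub_pos.2 h
    have e : S.before (S.rank a b) q a ↔ S.rank a b ≤ S.rank q a := by
      simp [before, h, h.le]
    rw [e]
    unfold slopeOf at hm1 hm2
    rw [div_lt_div_iff₀ hpos hpos'] at hm1
    rw [div_lt_div_iff₀ hpos' hpos] at hm2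
    unfold sideOf at h0 ⊢
    constructor
    · intro h1
      by_contra h2
      have h3 := lt_of_le_of_ne (not_lt.1 h2) h0.symm
      have := hm2 (by linarith)
      omega
    · intro h1
      exact (hm1 (by linarith)).le
  · have hpos' : 0 < u q - u a := sub_pos.2 h
    have e : S.before (S.rank a b) q a ↔ S.rank q a < S.rank a b := by
      simp [before, h, h.le]
    rw [e]
    rw [slopeOf_comm u v q a] at hm1 hm2
    unfold slopeOf at hm1 hm2
    rw [div_lt_div_iff₀ hpos hpos'] at hm1
    rw [div_lt_div_iff₀ hpos' hpos] at hm2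
    unfold sideOf at h0 ⊢
    constructor
    · intro h1
      by_contra h2
      have h3 := lt_of_le_of_ne (not_lt.1 h2) h0.symm
      have := hm1 (by linarith)
      omega
    · intro h1
      exact hm2 (by linarith)

/-- The slope of `xz` is a weighted mean of those of `xy` and `yz`, which differ because the points
are not collinear. -/
lemma rank_between (hg : NoThreeCollinear u v) {x y z : P} (hxy : u x < u y) (hyz : u y < u z) :
    (S.rank x y < S.rank x z ∧ S.rank x z < S.rank y z) ∨
      (S.rank y z < S.rank x z ∧ S.rank x z < S.rank x y) := by
  have hxz := hxy.trans hyz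
  have n1 : x ≠ y := fun h => by rw [h] at hxy; exact lt_irrefl _ hxy
  have n2 : y ≠ z := fun h => by rw [h] at hyz; exact lt_irrefl _ hyz
  have n3 : x ≠ z := fun h => by rw [h] at hxz; exact lt_irrefl _ hxz
  have p1 : 0 < u y - u x := sub_pos.2 hxy
  have p2 : 0 < u z - u y := sub_pos.2 hyz
  have p3 : 0 < u z - u x := sub_pos.2 hxz
  have h0 := hg x y z n1 n3.symm n2.symm
  rcases lt_or_gt_of_ne h0 with h | h <;> unfold sideOf at h
  · right
    constructor <;> refine S.mono _ _ _ _ (by assumption) (by assumption) ?_ <;> unfold slopeOf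
    · rw [div_lt_div_iff₀ p2 p3]; linarith
    · rw [div_lt_div_iff₀ p3 p1]; linarith
  · left
    constructor <;> refine S.mono _ _ _ _ (by assumption) (by assumption) ?_ <;> unfold slopeOf
    · rw [div_lt_div_iff₀ p1 p3]; linarith
    · rw [div_lt_div_iff₀ p3 p2]; linarith

/-- Of three points the outer pair is reversed between the other two pairs, by `rank_between`, and
this excludes cyclic orders. -/
lemma before_trans (hg : NoThreeCollinear u v) (hu : Function.Injective u) {s : ℤ} {p q r : P}
    (h1 : S.before s p q) (h2 : S.before s q r) : S.before s p r := by
  have hpr : p ≠ r := by rintro rfl; exact S.before_asymm h1 h2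
  have h3 := lt_or_gt_of_ne (hu.ne hpr)
  have b1 := S.rank_between hg (x := p) (y := q) (z := r)
  have b2 := S.rank_between hg (x := p) (y := r) (z := q)
  have b3 := S.rank_between hg (x := q) (y := p) (z := r)
  have b4 := S.rank_between hg (x := q) (y := r) (z := p)
  have b5 := S.rank_between hg (x := r) (y := p) (z := q)
  have b6 := S.rank_between hg (x := r) (y := q) (z := p)
  rw [S.symm q p] at b3 b4 b6
  rw [S.symm r p] at b4 b5 b6
  rw [S.symm r q] at b2 b5 b6
  unfold before at h1 h2 ⊢
  rcases h1 with h1 | h1 <;> rcases h2 with h2 | h2 <;> rcases h3 with h3 | h3 <;>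
    simp only [h1.2, h2.2, h3, lt_asymm h1.2, lt_asymm h2.2, lt_asymm h3, forall_true_left,
      and_true, and_false, or_false, false_or, IsEmpty.forall_iff] at * <;> omega

open Classical in
/-- The position of a point in the order `before s`. -/
noncomputable def place [Fintype P] (s : ℤ) (p : P) : ℤ :=
  (Finset.univ.filter fun q => S.before s q p).card + 1

lemma place_lt_of_before [Fintype P] (hg : NoThreeCollinear u v) (hu : Function.Injective u)
    {s : ℤ} {p q : P} (h : S.before s p q) : S.place s p < S.place s q := by
  classical
  unfold place
  have : (Finset.univ.filter fun x => S.before s x p) ⊂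
      Finset.univ.filter fun x => S.before s x q := by
    refine Finset.ssubset_iff_subset_ne.2 ⟨fun x hx => ?_, fun heq => ?_⟩
    · simp only [Finset.mem_filter, Finset.mem_univ, true_and] at hx ⊢
      exact S.before_trans hg hu hx h
    · have : p ∈ Finset.univ.filter fun x => S.before s x p := by rw [heq]; simpa using h
      exact S.before_irrefl s p (by simpa using this)
  have := Finset.card_lt_card this
  omega

lemma place_lt_iff [Fintype P] (hg : NoThreeCollinear u v) (hu : Function.Injective u)
    {s : ℤ} {p q : P} : S.place s p < S.place s q ↔ S.before s p q := by
  refine ⟨fun h => ?_, S.place_lt_of_before hg hu⟩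
  have hne : p ≠ q := by rintro rfl; exact lt_irrefl _ h
  rcases S.before_total hu s hne with h' | h'
  · exact h'
  · exact absurd (S.place_lt_of_before hg hu h') (lt_asymm h)

lemma place_injective [Fintype P] (hg : NoThreeCollinear u v) (hu : Function.Injective u)
    (s : ℤ) : Function.Injective (S.place s) := by
  intro p q h
  by_contra hne
  rcases S.before_total hu s hne with h' | h' <;> have := S.place_lt_of_before hg hu h' <;> omega

lemma one_le_place [Fintype P] (s : ℤ) (p : P) : 1 ≤ S.place s p := by
  unfold place; omega

lemma place_le_card [Fintype P] (s : ℤ) (p : P) : S.place s p ≤ Fintype.card P := by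
  classical
  have : (Finset.univ.filter fun x => S.before s x p) ⊂ Finset.univ := by
    refine Finset.ssubset_univ_iff.2 fun h => ?_
    have : p ∈ Finset.univ.filter fun x => S.before s x p := by rw [h]; simp
    exact S.before_irrefl s p (by simpa using this)
  have := Finset.card_lt_card this
  rw [Finset.card_univ] at this
  unfold place
  omega

lemma place_reverse [Fintype P] (hu : Function.Injective u) (p : P) :
    S.place M p = Fintype.card P + 1 - S.place 0 p := by
  classical
  have h : (Finset.univ.filter fun q => S.before M q p) =
      (insert p (Finset.univ.filter fun q => S.before 0 q p))ᶜ := by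
    ext q
    simp only [Finset.mem_filter, Finset.mem_univ, true_and, Finset.mem_compl, Finset.mem_insert]
    by_cases hq : q = p
    · subst hq; simp [S.before_irrefl]
    · have h1 := S.lt q p hq
      have h2 := S.nonneg q p
      have h3 := lt_or_gt_of_ne (hu.ne hq)
      unfold before
      rcases h3 with h3 | h3 <;> simp [h1, h2, h3, hq, not_le.2 h1, not_lt.2 h2, h3.le]
  unfold place
  rw [h, Finset.card_compl, Finset.card_insert_of_notMem (by simp [S.before_irrefl])]
  have := S.place_le_card 0 p
  unfold place at this
  omega

lemma before_add_one_iff (hu : Function.Injective u) {a b p q : P} (hab : u a < u b)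
    (h : ¬ (p = a ∧ q = b)) (h' : ¬ (p = b ∧ q = a)) :
    S.before (S.rank a b + 1) p q ↔ S.before (S.rank a b) p q := by
  by_cases hpq : p = q
  · subst hpq; simp [S.before_irrefl]
  have : S.rank p q ≠ S.rank a b := by
    intro heq
    rcases lt_or_gt_of_ne (hu.ne hpq) with h1 | h1
    · exact h (S.inj p q a b h1 hab heq)
    · rw [S.symm] at heq
      have := S.inj q p a b h1 hab heq
      exact h' ⟨this.2, this.1⟩
  unfold before
  have e1 : S.rank a b + 1 ≤ S.rank p q ↔ S.rank a b ≤ S.rank p q := by omega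
  have e2 : S.rank p q < S.rank a b + 1 ↔ S.rank p q < S.rank a b := by omega
  rw [e1, e2]

/-- The points `a` and `b` are neighbours when they swap: a point between them would still be after
`a` and before `b` once their order is reversed, against transitivity. -/
lemma before_right_iff (hg : NoThreeCollinear u v) (hu : Function.Injective u) {a b q : P}
    (hab : u a < u b) (hqa : q ≠ a) :
    S.before (S.rank a b) q b ↔ S.before (S.rank a b) q a := by
  by_cases hqb : q = b
  · subst hqb
    simp [before, hab.le, S.symm q a]
  have hsab : S.before (S.rank a b) a b := Or.inl ⟨le_rfl, hab⟩
  constructor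
  · intro h
    by_contra hcon
    have h1 := (S.before_total hu (S.rank a b) hqa).resolve_left hcon
    rw [← S.before_add_one_iff hu hab (by tauto) (by tauto)] at h h1
    have h2 := S.before_trans hg hu h1 h
    have h3 : S.before (S.rank a b + 1) b a := Or.inr ⟨by rw [S.symm b a]; omega, hab⟩
    exact S.before_asymm h2 h3
  · intro h
    exact S.before_trans hg hu h hsab

lemma place_swap [Fintype P] (hg : NoThreeCollinear u v) (hu : Function.Injective u) {a b : P}
    (hab : u a < u b) :
    S.place (S.rank a b) b = S.place (S.rank a b) a + 1 ∧
    S.place (S.rank a b + 1) a = S.place (S.rank a b) b ∧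
    S.place (S.rank a b + 1) b = S.place (S.rank a b) a ∧
    ∀ p, p ≠ a → p ≠ b → S.place (S.rank a b + 1) p = S.place (S.rank a b) p := by
  classical
  have hne : a ≠ b := fun h => by rw [h] at hab; exact lt_irrefl _ hab
  have hsab : S.before (S.rank a b) a b := Or.inl ⟨le_rfl, hab⟩
  have hsba : S.before (S.rank a b + 1) b a := Or.inr ⟨by rw [S.symm b a]; omega, hab⟩
  set s := S.rank a b with hs
  have e1 : (Finset.univ.filter fun q => S.before s q b) =
      insert a (Finset.univ.filter fun q => S.before s q a) := by
    ext q
    simp only [Finset.mem_filter, Finset.mem_univ, true_and, Finset.mem_insert]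
    by_cases hq : q = a
    · subst hq; simp [hsab]
    · simp [hq, hs, S.before_right_iff hg hu hab hq]
  have e2 : (Finset.univ.filter fun q => S.before (s + 1) q a) =
      insert b (Finset.univ.filter fun q => S.before s q a) := by
    ext q
    simp only [Finset.mem_filter, Finset.mem_univ, true_and, Finset.mem_insert]
    by_cases hq : q = b
    · subst hq; simp [hsba]
    · simp only [hq, false_or]
      by_cases hq' : q = a
      · subst hq'; simp [S.before_irrefl]
      · exact S.before_add_one_iff hu hab (by tauto) (by tauto)
  have e3 : (Finset.univ.filter fun q => S.before (s + 1) q b) =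
      Finset.univ.filter fun q => S.before s q a := by
    ext q
    simp only [Finset.mem_filter, Finset.mem_univ, true_and]
    by_cases hq : q = a
    · subst hq; simp [S.before_irrefl, S.before_asymm hsba]
    · by_cases hq' : q = b
      · subst hq'; simp [S.before_irrefl, S.before_asymm hsab]
      · rw [← S.before_right_iff hg hu hab hq]
        exact S.before_add_one_iff hu hab (by tauto) (by tauto)
  have e4 : (insert a (Finset.univ.filter fun q => S.before s q a)).card =
      (Finset.univ.filter fun q => S.before s q a).card + 1 :=
    Finset.card_insert_of_notMem (by simp [S.before_irrefl])
  have e5 : (insert b (Finset.univ.filter fun q => S.before s q a)).card =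
      (Finset.univ.filter fun q => S.before s q a).card + 1 :=
    Finset.card_insert_of_notMem (by simp [S.before_asymm hsab])
  unfold place
  rw [e1, e2, e3, e4, e5]
  refine ⟨by push_cast; ring, rfl, rfl, fun p hpa hpb => ?_⟩
  congr 3
  ext q
  simp only [Finset.mem_filter, Finset.mem_univ, true_and]
  exact S.before_add_one_iff hu hab (by tauto) (by tauto)

/-- The periodic extension of `place`. -/
noncomputable def extPlace [Fintype P] (t : ℤ) (p : P) : ℤ :=
  if Even (t / M) then S.place (t % M) p else Fintype.card P + 1 - S.place (t % M) p

lemma extPlace_eq [Fintype P] (hu : Function.Injective u) (hM : 0 < M) {k s : ℤ} (h0 : 0 ≤ s)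
    (h1 : s ≤ M) (p : P) : S.extPlace (k * M + s) p =
      if Even k then S.place s p else Fintype.card P + 1 - S.place s p := by
  unfold extPlace
  -- The time `s = M` already belongs to the next period; `place_reverse` makes the two descriptions
  -- agree.
  rcases h1.eq_or_lt with rfl | h1
  · rw [show k * s + s = (k + 1) * s by ring, Int.mul_ediv_cancel _ hM.ne', Int.mul_emod_left,
      S.place_reverse hu]
    simp only [Int.even_add_one]
    split_ifs <;> ring
  · rw [show k * M + s = s + k * M by ring, Int.add_mul_ediv_right _ _ hM.ne',
      Int.ediv_eq_zero_of_lt h0 h1, Int.add_mul_emod_self_right, Int.emod_eq_of_lt h0 h1, zero_add]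

/-- The allowable sequence of a planar point set. -/
noncomputable def toAllowableSequence [Fintype P] (hg : NoThreeCollinear u v)
    (hu : Function.Injective u) (hM : 0 < M) : AllowableSequence P M where
  pos := S.extPlace
  inj t p q h := by
    unfold extPlace at h
    split_ifs at h
    · exact S.place_injective hg hu _ h
    · exact S.place_injective hg hu (t % M) (by omega)
  one_le t p := by
    have := S.one_le_place (t % M) p
    have := S.place_le_card (t % M) p
    unfold extPlace
    split_ifs <;> omega
  le_card t p := by
    have := S.one_le_place (t % M) p
    have := S.place_le_card (t % M) p
    unfold extPlace
    split_ifs <;> omega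
  swap t := by
    have h0 := Int.emod_nonneg t hM.ne'
    have h1 := Int.emod_lt_of_pos t hM
    obtain ⟨a, b, hab, hs⟩ := S.surj _ h0 h1
    obtain ⟨e1, e2, e3, e4⟩ := S.place_swap hg hu hab
    rw [hs] at e1 e2 e3 e4
    have f1 : ∀ p, S.extPlace t p = if Even (t / M) then
        S.place (t % M) p else Fintype.card P + 1 - S.place (t % M) p := fun p => by
      conv_lhs => rw [← Int.ediv_mul_add_emod t M]
      exact S.extPlace_eq hu hM h0 h1.le p
    have f2 : ∀ p, S.extPlace (t + 1) p = if Even (t / M) then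
        S.place (t % M + 1) p else Fintype.card P + 1 - S.place (t % M + 1) p := fun p => by
      conv_lhs => rw [← Int.ediv_mul_add_emod t M, add_assoc]
      exact S.extPlace_eq hu hM (by omega) (by omega) p
    by_cases hk : Even (t / M)
    · simp only [hk, if_true] at f1 f2
      refine ⟨a, b, ?_, ?_, ?_, fun p hpa hpb => ?_⟩ <;> simp only [f1, f2]
      · exact e1
      · exact e2
      · exact e3
      · exact e4 p hpa hpb
    · simp only [hk, if_false] at f1 f2
      -- In an odd period the order is reversed, so `b` is now the left element of the pair.
      refine ⟨b, a, ?_, ?_, ?_, fun p hpb hpa => ?_⟩ <;> simp only [f1, f2]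
      · omega
      · omega
      · omega
      · rw [e4 p hpa hpb]
  anti t p := by
    unfold extPlace
    rw [Int.add_emod_right, show t + M = t + 1 * M by ring, Int.add_mul_ediv_right _ _ hM.ne']
    simp only [Int.even_add_one]
    split_ifs <;> ring

end SlopeRank

open Classical in
/-- In a planar point set without three points on a line there are at least as many bichromatic
pairs with balanced sides as points of the smaller color class. -/
theorem le_card_balanced_pairs {P : Type*} [Fintype P] {u v : P → ℝ} (hu : Function.Injective u)
    (hg : NoThreeCollinear u v) {c : P → ℤ} (hc : ∀ p, c p = 1 ∨ c p = -1) {d r : ℤ}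
    (hd0 : 0 ≤ d) (hr : 0 ≤ r) (hd : ∑ p, c p = 2 * d)
    (hn : (Fintype.card P : ℤ) = 2 * r + 2 * d) :
    r ≤ (Finset.univ.filter fun x : P × P => u x.1 < u x.2 ∧ c x.2 = -c x.1 ∧
      ∑ q with sideOf u v x.1 x.2 q < 0, c q = d).card := by
  obtain ⟨M, hM, ⟨S⟩⟩ := exists_slopeRank v hu
  rcases hM.eq_or_lt with rfl | hM
  · have : Subsingleton P := by
      refine ⟨fun p q => ?_⟩
      by_contra h
      have := S.lt p q h
      have := S.nonneg p q
      omega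
    have := Fintype.card_le_one_iff_subsingleton.2 this
    omega
  · refine ((S.toAllowableSequence hg hu hM).le_card_balanced hc hd0 hr hd hn hM).trans ?_
    norm_cast
    have hpos : ∀ t, 0 ≤ t → t ≤ M → ∀ p,
        (S.toAllowableSequence hg hu hM).pos t p = S.place t p := by
      intro t h0 h1 p
      have := S.extPlace_eq hu hM (k := 0) h0 h1 p
      rw [if_pos (by decide), zero_mul, zero_add] at this
      exact this
    -- Each balanced time is the rank of the pair swapped at it, so balanced times are covered by
    -- the ranks of balanced pairs.
    refine (Finset.card_le_card (t := (Finset.univ.filter fun x : P × P => u x.1 < u x.2 ∧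
      c x.2 = -c x.1 ∧ ∑ q with sideOf u v x.1 x.2 q < 0, c q = d).image
        fun x => S.rank x.1 x.2) ?_).trans Finset.card_image_le
    intro t ht
    simp only [Finset.mem_filter, Finset.mem_Ico] at ht
    obtain ⟨⟨h0, h1⟩, a, b, ha, hb, hcab, hsum⟩ := ht
    rw [hpos t h0 h1.le, hpos t h0 h1.le] at ha
    rw [hpos t h0 h1.le, hpos (t + 1) (by omega) (by omega)] at hb
    simp only [hpos t h0 h1.le] at hsum
    obtain ⟨a', b', hab, rfl⟩ := S.surj t h0 h1
    obtain ⟨e1, e2, e3, e4⟩ := S.place_swap hg hu hab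
    have hab' : a = a' ∧ b = b' := by
      have : a = a' := by
        by_contra hcon
        by_cases h : a = b'
        · subst h; omega
        · have := e4 a hcon h; omega
      subst this
      exact ⟨rfl, S.place_injective hg hu _ (ha.trans e1.symm)⟩
    obtain ⟨rfl, rfl⟩ := hab'
    refine Finset.mem_image.2 ⟨(a, b), ?_, rfl⟩
    simp only [S.place_lt_iff hg hu, S.before_left_iff hg hu hab] at hsum
    simp only [Finset.mem_filter, Finset.mem_univ, true_and]
    exact ⟨hab, hcab, hsum⟩

/-! ### Coordinates, lines and sides in the plane -/

/-- The first coordinate after a shear. -/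
def shear (k : ℝ) (p : Plane) : ℝ := p 0 + k * p 1

/-- The second coordinate. -/
def height (p : Plane) : ℝ := p 1

lemma Plane.ext_iff' {p q : Plane} : p = q ↔ p 0 = q 0 ∧ p 1 = q 1 := by
  constructor
  · rintro rfl; exact ⟨rfl, rfl⟩
  · rintro ⟨h0, h1⟩
    ext i
    fin_cases i
    · exact h0
    · exact h1

/-- Each pair of distinct points excludes at most one value of `k`. -/
lemma exists_shear_injOn (P : Finset Plane) : ∃ k : ℝ, Set.InjOn (shear k) P := by
  classical
  obtain ⟨k, hk⟩ := Infinite.exists_notMem_finset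
    ((P ×ˢ P).image fun x => -(x.1 0 - x.2 0) / (x.1 1 - x.2 1))
  refine ⟨k, fun p hp q hq h => ?_⟩
  unfold shear at h
  by_cases h1 : p 1 = q 1
  · exact Plane.ext_iff'.2 ⟨by rw [h1] at h; linarith, h1⟩
  · exfalso
    apply hk
    refine Finset.mem_image.2 ⟨(p, q), Finset.mem_product.2 ⟨hp, hq⟩, ?_⟩
    have h2 : p 1 - q 1 ≠ 0 := sub_ne_zero.2 h1
    rw [div_eq_iff h2]
    linarith

lemma mem_line_iff {k : ℝ} {a b : Plane} (hab : shear k a ≠ shear k b) (y : Plane) :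
    y ∈ line[ℝ, a, b] ↔ sideOf (shear k) height a b y = 0 := by
  rw [mem_affineSpan_pair_iff_exists_lineMap_eq]
  have h0 : shear k b - shear k a ≠ 0 := sub_ne_zero.2 hab.symm
  constructor
  · rintro ⟨t, rfl⟩
    simp [AffineMap.lineMap_apply, sideOf, shear, height]
    ring
  · intro h
    refine ⟨(shear k y - shear k a) / (shear k b - shear k a), ?_⟩
    have h1 : y 1 - a 1 = (shear k y - shear k a) / (shear k b - shear k a) * (b 1 - a 1) := by
      rw [div_mul_eq_mul_div, eq_div_iff h0]
      unfold sideOf height at h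
      linarith
    have h2 : shear k y - shear k a =
        (shear k y - shear k a) / (shear k b - shear k a) * (shear k b - shear k a) := by
      rw [div_mul_cancel₀ _ h0]
    set t := (shear k y - shear k a) / (shear k b - shear k a)
    rw [Plane.ext_iff']
    unfold shear at h2
    simp only [AffineMap.lineMap_apply, vsub_eq_sub, vadd_eq_add, PiLp.add_apply, PiLp.smul_apply,
      PiLp.sub_apply, smul_eq_mul]
    constructor
    · linear_combination -h2 + k * h1
    · linear_combination -h1

/-- The function `sideOf` is affine in its last argument and vanishes exactly on the line, so its
sign tells the sides apart. -/
lemma sSameSide_iff {k : ℝ} {a b : Plane} (hab : shear k a ≠ shear k b) (x y : Plane) :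
    (line[ℝ, a, b]).SSameSide x y ↔
      0 < sideOf (shear k) height a b x * sideOf (shear k) height a b y := by
  have hlin : ∀ (s : ℝ) (z p : Plane),
      sideOf (shear k) height a b (s • (z - p) + a) = s * (sideOf (shear k) height a b z -
        sideOf (shear k) height a b p) := by
    intro s z p
    simp [sideOf, shear, height]
    ring
  have ha : sideOf (shear k) height a b a = 0 := by simp [sideOf]
  have haff : ∀ (z p : Plane), sideOf (shear k) height a b (z - p + a) =
      sideOf (shear k) height a b z - sideOf (shear k) height a b p := by
    intro z p
    simpa using hlin 1 z p
  have hzero : sideOf (shear k) height a b (0 + a) = 0 := by rw [zero_add, ha]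
  unfold AffineSubspace.SSameSide AffineSubspace.WSameSide
  rw [mem_line_iff hab, mem_line_iff hab]
  constructor
  · rintro ⟨⟨p, hp, q, hq, hray⟩, hx, hy⟩
    rw [mem_line_iff hab] at hp hq
    rw [vsub_eq_sub, vsub_eq_sub] at hray
    rcases hray with h | h | ⟨s, t, hs, ht, h⟩
    · have := haff x p
      rw [h, hzero, hp, sub_zero] at this
      exact absurd this.symm hx
    · have := haff y q
      rw [h, hzero, hq, sub_zero] at this
      exact absurd this.symm hy
    · have h1 := hlin s x p
      rw [h, hlin, hp, hq, sub_zero, sub_zero] at h1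
      have h2 : 0 < sideOf (shear k) height a b x ^ 2 := by positivity
      have h3 : 0 < s * sideOf (shear k) height a b x ^ 2 := mul_pos hs h2
      have h4 : s * sideOf (shear k) height a b x ^ 2 =
          t * (sideOf (shear k) height a b x * sideOf (shear k) height a b y) := by
        linear_combination -sideOf (shear k) height a b x * h1
      rw [h4] at h3
      exact (mul_pos_iff_of_pos_left ht).1 h3
  · intro h
    have hx : sideOf (shear k) height a b x ≠ 0 := by
      rintro h'; simp [h'] at h
    have hy : sideOf (shear k) height a b y ≠ 0 := by
      rintro h'; simp [h'] at h
    refine ⟨?_, hx, hy⟩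
    set s := sideOf (shear k) height a b y / sideOf (shear k) height a b x with hs
    have hspos : 0 ≤ s := by
      rw [hs, ← mul_div_mul_left _ _ hx]
      exact (div_pos h (mul_self_pos.2 hx)).le
    -- The ratio `s` is chosen so that `s • (x - a)` leads from a point of the line to `y`.
    refine ⟨a, (mem_line_iff hab a).2 ha, y - s • (x - a), ?_, ?_⟩
    · rw [mem_line_iff hab]
      have h1 := haff y (s • (x - a) + a)
      rw [hlin, ha, sub_zero, hs, div_mul_cancel₀ _ hx, sub_self] at h1
      rw [← h1]
      congr 1
      module
    · rw [vsub_eq_sub, vsub_eq_sub, sub_sub_cancel]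
      exact SameRay.sameRay_nonneg_smul_right _ hspos

/-! ### From weighted pairs to balanced lines -/

open Classical in
/-- The color of a point as a weight. -/
noncomputable def colorWeight (B : Finset Plane) (p : Plane) : ℤ := if p ∈ B then 1 else -1

open Classical in
lemma excess_eq_sum {B R : Finset Plane} (hdisj : Disjoint B R) (H : Set Plane) :
    excess B R H = ∑ q : ↥(B ∪ R), if (q : Plane) ∈ H then colorWeight B q else 0 := by
  have e1 : (∑ q : ↥(B ∪ R), if (q : Plane) ∈ H then colorWeight B q else 0) =
      ∑ q ∈ B ∪ R, if q ∈ H then colorWeight B q else 0 :=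
    Finset.sum_coe_sort (B ∪ R) fun q => if q ∈ H then colorWeight B q else 0
  have e2 : ∀ A : Finset Plane, (↑A ∩ H : Set Plane).ncard = (A.filter (· ∈ H)).card := by
    intro A
    rw [← Set.ncard_coe_finset]
    congr 1
    ext; simp
  have e3 : ∀ q ∈ B, (if q ∈ H then colorWeight B q else 0) = if q ∈ H then 1 else 0 := by
    intro q hq; simp [colorWeight, hq]
  have e4 : ∀ q ∈ R, (if q ∈ H then colorWeight B q else 0) = -if q ∈ H then 1 else 0 := by
    intro q hq
    have : q ∉ B := fun h => Finset.disjoint_left.1 hdisj h hq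
    split_ifs <;> simp [colorWeight, this]
  rw [e1, Finset.sum_union hdisj, Finset.sum_congr rfl e3, Finset.sum_congr rfl e4,
    Finset.sum_neg_distrib]
  unfold excess
  rw [e2, e2]
  simp [sub_eq_add_neg]

lemma noThreeCollinear_of_inGeneralPosition {P : Finset Plane} (hgen : InGeneralPosition ↑P)
    {k : ℝ} (hk : Set.InjOn (shear k) P) :
    NoThreeCollinear (fun p : P => shear k p) (fun p : P => height p) := by
  intro a b q hab hqa hqb h
  have hne : shear k a ≠ shear k b := fun h' => hab (Subtype.ext (hk a.2 b.2 h'))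
  refine hgen a a.2 b b.2 q q.2 (Subtype.coe_ne_coe.2 hab) (Subtype.coe_ne_coe.2 hqa.symm)
    (Subtype.coe_ne_coe.2 hqb.symm) ?_
  have hq : (q : Plane) ∈ line[ℝ, (a : Plane), (b : Plane)] := (mem_line_iff hne q).2 h
  have := collinear_insert_of_mem_affineSpan_pair hq
  rwa [Set.insert_comm, Set.pair_comm (q : Plane)] at this

-- The two spanning points have opposite weights and are the only ones on the line, so a total of `2
-- * d` with `d` on one side leaves `d` on the other.
open Classical in
lemma isBalancedLine_of_sum_eq {B R : Finset Plane} (hdisj : Disjoint B R) {k : ℝ}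
    (hu : Function.Injective fun p : ↥(B ∪ R) => shear k p)
    (hg : NoThreeCollinear (fun p : ↥(B ∪ R) => shear k p) (fun p : ↥(B ∪ R) => height p)) {d : ℤ}
    (hd : (B.card : ℤ) - R.card = 2 * d) {a b : ↥(B ∪ R)} (hab : a ≠ b)
    (hc : colorWeight B b = -colorWeight B a)
    (hsum : (∑ q : ↥(B ∪ R), if sideOf (shear k) height (a : Plane) b q < 0 then
      colorWeight B q else 0) = d) :
    IsBalancedLine B R line[ℝ, (a : Plane), (b : Plane)] := by
  have hne : shear k a ≠ shear k b := hu.ne hab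
  have htot : ∑ q : ↥(B ∪ R), colorWeight B q = 2 * d := by
    have h1 := excess_eq_sum hdisj Set.univ
    simp only [excess, Set.inter_univ, Set.ncard_coe_finset, Set.mem_univ, if_true] at h1
    rw [← h1, hd]
  have hpos : (∑ q : ↥(B ∪ R), if 0 < sideOf (shear k) height (a : Plane) b q then
      colorWeight B q else 0) = d := by
    have h1 : (∑ q : ↥(B ∪ R), if sideOf (shear k) height (a : Plane) b q = 0 then
        colorWeight B q else 0) = 0 := by
      have h2 : (Finset.univ.filter fun q : ↥(B ∪ R) =>
          sideOf (shear k) height (a : Plane) b q = 0) = {a, b} := by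
        ext q
        simp only [Finset.mem_filter, Finset.mem_univ, true_and, Finset.mem_insert,
          Finset.mem_singleton]
        constructor
        · intro h
          by_contra! hcon
          exact hg a b q hab hcon.1 hcon.2 h
        · rintro (rfl | rfl)
          · simp [sideOf]
          · simp [sideOf]
      rw [← Finset.sum_filter, h2, Finset.sum_pair hab, hc]; ring
    have h3 : ∀ q : ↥(B ∪ R), colorWeight B q =
        ((if sideOf (shear k) height (a : Plane) b q < 0 then colorWeight B q else 0) +
        (if sideOf (shear k) height (a : Plane) b q = 0 then colorWeight B q else 0)) +
        (if 0 < sideOf (shear k) height (a : Plane) b q then colorWeight B q else 0) := by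
      intro q
      rcases lt_trichotomy (sideOf (shear k) height (a : Plane) b q) 0 with h | h | h
      · simp [h, h.ne, h.le]
      · simp [h]
      · simp [h, h.ne', h.le]
    rw [Finset.sum_congr rfl fun q _ => h3 q, Finset.sum_add_distrib, Finset.sum_add_distrib,
      hsum, h1] at htot
    linarith
  have hR : ∀ q : ↥(B ∪ R), (q : Plane) ∉ B → (q : Plane) ∈ R := fun q hq =>
    (Finset.mem_union.1 q.2).resolve_left hq
  have hab' : (a : Plane) ≠ b := fun h => hab (Subtype.ext h)
  refine ⟨?_, ?_⟩
  · unfold colorWeight at hc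
    by_cases ha : (a : Plane) ∈ B <;> by_cases hb : (b : Plane) ∈ B
    · simp [ha, hb] at hc
    · exact ⟨a, ha, b, hR b hb, hab', rfl⟩
    · exact ⟨b, hb, a, hR a ha, hab'.symm, by rw [Set.pair_comm]⟩
    · simp [ha, hb] at hc
  · rintro H ⟨x, hx, rfl⟩
    rw [mem_line_iff hne] at hx
    rw [excess_eq_sum hdisj, hd]
    simp only [Set.mem_ofPred_eq, sSameSide_iff hne]
    rcases lt_or_gt_of_ne hx with h | h
    · have e : ∀ z : ℝ, 0 < sideOf (shear k) height (a : Plane) b x * z ↔ z < 0 := fun z =>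
        ⟨fun hz => neg_of_mul_pos_right hz h.le, fun hz => mul_pos_of_neg_of_neg h hz⟩
      simp only [e]
      rw [hsum]
    · simp only [mul_pos_iff_of_pos_left h]
      rw [hpos]

theorem theorem1 (B R : Finset Plane) (hdisj : Disjoint B R)
    (hgen : InGeneralPosition (↑B ∪ ↑R)) (hle : R.card ≤ B.card)
    (heven : Even (B.card + R.card)) :
    R.card ≤ {l : AffineSubspace ℝ Plane | IsBalancedLine B R l}.ncard := by
  classical
  rw [← Finset.coe_union] at hgen
  obtain ⟨k, hk⟩ := exists_shear_injOn (B ∪ R)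
  have hg := noThreeCollinear_of_inGeneralPosition hgen hk
  have hu : Function.Injective fun p : ↥(B ∪ R) => shear k p :=
    fun p q h => Subtype.ext (hk p.2 q.2 h)
  obtain ⟨m, hm⟩ := heven
  -- Here `m` is half the number of points, so `m - R.card` is half the color difference.
  have hd : (B.card : ℤ) - R.card = 2 * ((m : ℤ) - R.card) := by omega
  have hcard : (Fintype.card ↥(B ∪ R) : ℤ) = 2 * R.card + 2 * ((m : ℤ) - R.card) := by
    rw [Fintype.card_coe, Finset.card_union_of_disjoint hdisj]; omega
  have htot : ∑ q : ↥(B ∪ R), colorWeight B q = 2 * ((m : ℤ) - R.card) := by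
    have h1 := excess_eq_sum hdisj Set.univ
    simp only [excess, Set.inter_univ, Set.ncard_coe_finset, Set.mem_univ, if_true] at h1
    rw [← h1, hd]
  have hmain := le_card_balanced_pairs hu hg (c := fun q => colorWeight B q)
    (fun p => by unfold colorWeight; split_ifs <;> simp) (by omega) (by omega) htot hcard
  refine (Nat.cast_le.1 hmain).trans ?_
  rw [← Set.ncard_coe_finset]
  refine Set.ncard_le_ncard_of_injOn (fun x => line[ℝ, (x.1 : Plane), (x.2 : Plane)]) ?_ ?_ ?_
  · intro x hx
    simp only [Finset.coe_filter, Finset.mem_univ, true_and, Set.mem_ofPred_eq] at hx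
    exact isBalancedLine_of_sum_eq hdisj hu hg hd (fun h => by rw [h] at hx; exact lt_irrefl _ hx.1)
      hx.2.1 (by rw [← hx.2.2, Finset.sum_filter]; rfl)
  · rintro ⟨a, b⟩ hx ⟨a', b'⟩ hy h
    simp only [Finset.coe_filter, Finset.mem_univ, true_and, Set.mem_ofPred_eq] at hx hy h
    -- The line contains no other point of the set, so it determines the pair up to order; the order
    -- is fixed by the sheared coordinate.
    have hab : a ≠ b := fun h => by rw [h] at hx; exact lt_irrefl _ hx.1
    have key : ∀ q : ↥(B ∪ R), (q : Plane) ∈ line[ℝ, (a : Plane), (b : Plane)] → q = a ∨ q = b := by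
      intro q hq
      by_contra! hcon
      exact hg a b q hab hcon.1 hcon.2 ((mem_line_iff (hu.ne hab) _).1 hq)
    have ha' := key a' (by rw [h]; exact left_mem_affineSpan_pair ℝ _ _)
    have hb' := key b' (by rw [h]; exact right_mem_affineSpan_pair ℝ _ _)
    have h1 := hx.1
    have h2 := hy.1
    rcases ha' with rfl | rfl <;> rcases hb' with rfl | rfl
    · exact absurd h2 (lt_irrefl _)
    · rfl
    · exact absurd h1 (lt_asymm h2)
    · exact absurd h2 (lt_irrefl _)
  -- Finiteness is needed because `ncard` of an infinite set is zero.
  · refine ((B ×ˢ R).image fun x => line[ℝ, x.1, x.2]).finite_toSet.subset ?_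
    rintro l ⟨⟨p, hp, q, hq, -, rfl⟩, -⟩
    exact Finset.mem_coe.2 (Finset.mem_image.2 ⟨(p, q), Finset.mem_product.2 ⟨hp, hq⟩, rfl⟩)
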